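/- Let $M,k\ge 0$ be integers with $4(k+1)\le M$. Let $so(M)$ be the complex orthogonal Lie algebra, with roots $\pm e_i\pm e_j$ (and $\pm e_i$ if $M$ is odd); write $e^k_j=e_{2k+j}$ and let $N$ be the integer part of $(M-4k)/2$. Let $g_k=so(M-4k)\subset so(M)$ be the regular subalgebra with weights $e^k_1,\dots,e^k_N$; thus $g_{k+1}=so(M-4(k+1))$. Let $E_{a\pm l}$, $E_a$, $E_{1+2}$, $E_{1-2}$, $E_{2-1}$ ($a=1,2$; $3\le l\le N$; $E_a$ only for odd $M$) be root vectors of $g_k$ for the roots $e^k_a\pm e^k_l$, $e^k_a$, $e^k_1+e^k_2$, $e^k_1-e^k_2$, $e^k_2-e^k_1$, normalized so that $$[E_{1+l},E_{2-l}]=[E_{1-l},E_{2+l}]=[E_1,E_2]=E_{1+2},\quad [E_{1-2},E_{2\pm l}]=-E_{1\pm l},\quad [E_{1-2},E_2]=-E_1,\quad [E_{1-2},E_{2-1}]=2H_{1-2},$$ where $H_{1\pm2}=\tfrac12(H_1\pm H_2)$ and $H_j$ is the Cartan element with $[H_j,E_\lambda]=\lambda_jE_\lambda$, $\lambda_j$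 being the coefficient of $e^k_j$ in $\lambda$ (the root vectors are realized by explicit skew-symmetric matrices with these relations). Put $$I^a=\epsilon\,\tfrac12E_a^2+\sum_{l=3}^N E_{a+l}E_{a-l},\qquad I^{1\otimes2}=\epsilon\,E_1\otimes E_2+\sum_{l=3}^N\left(E_{1+l}\otimes E_{2-l}+E_{1-l}\otimes E_{2+l}\right),$$ with $\epsilon=1$ for odd $M$ and $\epsilon=0$ for even $M$. Let $\eta$ be a formal deformation parameter, $\sigma=\ln(1+\eta E_{1+2})\in U(so(M))[[\eta]]$, and let $$F=\Phi_{{\cal E}_k}\Phi_{{\cal J}_k}=\exp\left\{\eta\, I^{1\otimes2}\,(1\otimes e^{-\sigma/2})\right\}\exp\left\{H_{1+2}\otimes\sigma\right\}\in (U(so(M))\otimes U(so(M)))[[\eta]]$$ be the extended Jordanian twist on the initial root $e^k_1+e^k_2$. Then $F$ is invertible. Equip $U(so(M))[[\eta]]$ with the twisted coproduct $\Delta_F(x)=F\Delta(x)F^{-1}$, where $\Delta$ is the standard coproduct, and call $x$ primitive if $\Delta_F(x)=x\otimes1+1\otimes x$. Put $$G_{1-2}=E_{1-2}-\eta I^1,\qquad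 G_{2-1}=E_{2-1}-\eta I^2e^{-\sigma}.$$ Then: 1. $I^1$ and $I^2$ commute with $g_{k+1}$. 2. $G_{1-2}$, $G_{2-1}$ and $H_{1-2}$ are primitive, and $[H_{1-2},G_{1-2}]=G_{1-2}$, $[H_{1-2},G_{2-1}]=-G_{2-1}$, $[G_{1-2},G_{2-1}]=2H_{1-2}$. 3. The complex span of $H_{1-2},G_{1-2},G_{2-1}$ is a Lie subalgebra $so_G(3)$ of $U(so(M))[[\eta]]$ (for the commutator) isomorphic to $so(3)$, and all its elements are primitive. 4. The canonical map $g_{k+1}\to U(so(M))[[\eta]]$ is injective. Its image $V(g_{k+1})$ commutes with $so_G(3)$ and meets it only in $0$. Their direct sum $V(g_{k+1})\oplus V(so_G(3))$ (the deformed carrier space) is a Lie subalgebra isomorphic to $so(M-4(k+1))\times so(3)$, and all its elements are primitive. -/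

import Mathlib

open scoped TensorProduct PowerSeries
open LieAlgebra.Orthogonal

attribute [local instance 100] LieRing.ofAssociativeRing

namespace FullChain

/-! ### The orthogonal Lie algebra `so(M)` and its root vectors

`so (Fin M) ℂ` is Mathlib's Lie algebra of complex skew-symmetric `M × M` matrices, i.e. the
orthogonal Lie algebra of the standard symmetric bilinear form on `ℂ^M`. -/

/-- The isotropic vector `v_j = ε_{2j-1} + i ε_{2j}` (`1 ≤ j ≤ M/2`), of weight `e_j`. -/
def posVec (M j : ℕ) : Fin M → ℂ := fun p =>
  if p.val + 2 = 2 * j then 1 else if p.val + 1 = 2 * j then Complex.I else 0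

/-- The isotropic vector `v_{-j} = (ε_{2j-1} - i ε_{2j}) / 2` (`1 ≤ j ≤ M/2`), of weight `-e_j`.
It is dual to `v_j`: the standard bilinear form takes the value `1` on `(v_j, v_{-j})`. -/
noncomputable def negVec (M j : ℕ) : Fin M → ℂ := fun p =>
  if p.val + 2 = 2 * j then 1 / 2 else if p.val + 1 = 2 * j then -(Complex.I / 2) else 0

/-- The last coordinate vector `v_0 = ε_M`; for odd `M` it is the unit vector of weight `0`. -/
def zeroVec (M : ℕ) : Fin M → ℂ := fun p => if p.val + 1 = M then 1 else 0

/-- The infinitesimal rotation `a ∧ b`, that is `x ↦ (b, x) a - (a, x) b`. If `a` and `b` have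
weights `μ` and `ν`, it is a weight vector of weight `μ + ν` for the adjoint action. -/
def wedge {M : ℕ} (a b : Fin M → ℂ) : so (Fin M) ℂ :=
  ⟨Matrix.vecMulVec a b - Matrix.vecMulVec b a, by
    rw [mem_so, Matrix.transpose_sub, Matrix.transpose_vecMulVec, Matrix.transpose_vecMulVec,
      neg_sub]⟩

/-- The matrix of the coordinate inclusion `ℂ^(M-s) → ℂ^M` onto the last `M - s` coordinates. -/
def shiftMatrix (M s : ℕ) : Matrix (Fin M) (Fin (M - s)) ℂ :=
  Matrix.of fun p q => if p.val = q.val + s then 1 else 0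

theorem shiftMatrix_transpose_mul (M s : ℕ) :
    (shiftMatrix M s).transpose * shiftMatrix M s = 1 := by
  ext a b
  have ha : a.val + s < M := by have := a.isLt; omega
  rw [Matrix.mul_apply, Finset.sum_eq_single ⟨a.val + s, ha⟩]
  · by_cases hab : a = b
    · subst hab; simp [shiftMatrix]
    · have : a.val ≠ b.val := fun h => hab (Fin.ext h)
      simp [shiftMatrix, hab, this]
  · intro p _ hp
    have : p.val ≠ a.val + s := fun h => hp (Fin.ext h)
    simp [shiftMatrix, this]
  · simp

/-- The injection `so(M-s) → so(M)` as the block acting on the last `M - s` coordinates.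
For `s = 4k` its image is the member `g_k = so(M-4k)` of the chain of subalgebras. -/
def soIncl (M s : ℕ) : so (Fin (M - s)) ℂ →ₗ⁅ℂ⁆ so (Fin M) ℂ where
  toFun x := ⟨shiftMatrix M s * x.val * (shiftMatrix M s).transpose, by
    have hx := (mem_so (Fin (M - s)) ℂ x.val).1 x.2
    rw [mem_so, Matrix.transpose_mul, Matrix.transpose_mul, Matrix.transpose_transpose, hx,
      Matrix.neg_mul, Matrix.mul_neg, Matrix.mul_assoc]⟩
  map_add' x y := Subtype.ext (by simp [Matrix.mul_add, Matrix.add_mul])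
  map_smul' c x := Subtype.ext (by simp)
  map_lie' {x y} := Subtype.ext (by
    have h (a b : Matrix (Fin (M - s)) (Fin (M - s)) ℂ) :
        shiftMatrix M s * a * (shiftMatrix M s).transpose *
          (shiftMatrix M s * b * (shiftMatrix M s).transpose) =
        shiftMatrix M s * (a * b) * (shiftMatrix M s).transpose := by
      calc _ = shiftMatrix M s * a * ((shiftMatrix M s).transpose * shiftMatrix M s) * b *
            (shiftMatrix M s).transpose := by simp only [Matrix.mul_assoc]
        _ = _ := by rw [shiftMatrix_transpose_mul]; simp only [Matrix.mul_one, Matrix.mul_assoc]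
    simp only [LieSubalgebra.coe_bracket, LieRing.of_associative_ring_bracket, h,
      Matrix.mul_sub, Matrix.sub_mul])

/-! Root vectors of `g_k = so(M-4k)`, whose weights are `e^k_j = e_{2k+j}`. They are normalized by
`[E_{1+l}, E_{2-l}] = [E_{1-l}, E_{2+l}] = [E_1, E_2] = E_{1+2}`, `[E_{1-2}, E_{2-1}] = 2 H_{1-2}`,
`[E_{1-2}, E_{2±l}] = -E_{1±l}`, `[E_{1-2}, E_2] = -E_1`. -/

/-- `E^k_{a+l}`, a root vector for `e^k_a + e^k_l` (used for `a = 1, 2` and `l ≥ 3`). -/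
def rootPlus (M k a l : ℕ) : so (Fin M) ℂ := wedge (posVec M (2 * k + a)) (posVec M (2 * k + l))

/-- `E^k_{a-l}`, a root vector for `e^k_a - e^k_l` (used for `a = 1, 2` and `l ≥ 3`). -/
noncomputable def rootMinus (M k a l : ℕ) : so (Fin M) ℂ :=
  wedge (posVec M (2 * k + a)) (negVec M (2 * k + l))

/-- `E^k_a`, a root vector for the short root `e^k_a` (used for `a = 1, 2` and odd `M`). -/
def rootShort (M k a : ℕ) : so (Fin M) ℂ := wedge (posVec M (2 * k + a)) (zeroVec M)

/-- `E^k_{1+2}`, a root vector for the initial root `e^k_1 + e^k_2`. -/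
def rootInit (M k : ℕ) : so (Fin M) ℂ := wedge (posVec M (2 * k + 2)) (posVec M (2 * k + 1))

/-- `E^k_{1-2}`, a root vector for `e^k_1 - e^k_2`. -/
noncomputable def root12 (M k : ℕ) : so (Fin M) ℂ :=
  wedge (negVec M (2 * k + 2)) (posVec M (2 * k + 1))

/-- `E^k_{2-1}`, a root vector for `e^k_2 - e^k_1`. -/
noncomputable def root21 (M k : ℕ) : so (Fin M) ℂ :=
  wedge (negVec M (2 * k + 1)) (posVec M (2 * k + 2))

/-- The Cartan element `H^k_j` dual to `e^k_j`: `[H^k_j, E_λ] = (coefficient of e^k_j in λ) E_λ`. -/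
noncomputable def cartan (M k j : ℕ) : so (Fin M) ℂ :=
  wedge (posVec M (2 * k + j)) (negVec M (2 * k + j))

/-- `H^k_{1+2} = (H^k_1 + H^k_2) / 2`. -/
noncomputable def cartanPlus (M k : ℕ) : so (Fin M) ℂ :=
  (1 / 2 : ℂ) • (cartan M k 1 + cartan M k 2)

/-- `H^k_{1-2} = (H^k_1 - H^k_2) / 2`. -/
noncomputable def cartanMinus (M k : ℕ) : so (Fin M) ℂ :=
  (1 / 2 : ℂ) • (cartan M k 1 - cartan M k 2)

/-! ### The universal enveloping algebra and its formal deformations -/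

/-- `U(so(M))`. -/
abbrev U (M : ℕ) : Type := UniversalEnvelopingAlgebra ℂ (so (Fin M) ℂ)

/-- The canonical map `so(M) → U(so(M))`. -/
noncomputable abbrev inU (M : ℕ) : so (Fin M) ℂ →ₗ⁅ℂ⁆ U M := UniversalEnvelopingAlgebra.ι ℂ

/-- The standard coproduct of `U(so(M))`: the algebra map with `Δ x = x ⊗ 1 + 1 ⊗ x` on `so(M)`. -/
noncomputable def comul (M : ℕ) : U M →ₐ[ℂ] U M ⊗[ℂ] U M :=
  UniversalEnvelopingAlgebra.lift ℂ
    { toFun := fun x => inU M x ⊗ₜ[ℂ] 1 + 1 ⊗ₜ[ℂ] inU M x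
      map_add' := fun x y => by
        rw [map_add, TensorProduct.add_tmul, TensorProduct.tmul_add]; abel
      map_smul' := fun c x => by
        rw [map_smul, RingHom.id_apply, smul_add, TensorProduct.smul_tmul', TensorProduct.tmul_smul]
      map_lie' := fun {x y} => by
        simp only [LieHom.map_lie, LieRing.of_associative_ring_bracket, mul_add, add_mul,
          Algebra.TensorProduct.tmul_mul_tmul, one_mul, mul_one, TensorProduct.sub_tmul,
          TensorProduct.tmul_sub]
        abel }

/-- For `φ = ∑ c_j X^j ∈ ℂ⟦X⟧` and a formal power series `f` without constant term over a (not
necessarily commutative) algebra `A`, the series `φ(f) = ∑ c_j f^j` in `A⟦X⟧`. The coefficient of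
`X^n` only involves `j ≤ n`, since `f^j` is divisible by `X^j`. -/
noncomputable def compSeries {A : Type} [Ring A] [Algebra ℂ A] (φ : ℂ⟦X⟧) (f : A⟦X⟧) : A⟦X⟧ :=
  PowerSeries.mk fun n =>
    ∑ j ∈ Finset.range (n + 1), PowerSeries.coeff j φ • PowerSeries.coeff n (f ^ j)

/-- `exp f`, for `f` without constant term. -/
noncomputable def fexp {A : Type} [Ring A] [Algebra ℂ A] (f : A⟦X⟧) : A⟦X⟧ :=
  compSeries (PowerSeries.exp ℂ) f

/-- `ln (1 + f)`, for `f` without constant term. -/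
noncomputable def flog {A : Type} [Ring A] [Algebra ℂ A] (f : A⟦X⟧) : A⟦X⟧ :=
  compSeries (PowerSeries.log ℂ) f

/-- Constants: the inclusion `A → A⟦X⟧`. -/
noncomputable def const {A : Type} [Ring A] [Algebra ℂ A] : A →ₐ[ℂ] A⟦X⟧ :=
  { (PowerSeries.C : A →+* A⟦X⟧) with commutes' := fun _ => PowerSeries.algebraMap_apply.symm }

/-- The deformation parameter `η`, the variable of `A⟦X⟧`. -/
noncomputable def eta {A : Type} [Ring A] : A⟦X⟧ := PowerSeries.X

/-! `(U M ⊗ U M)⟦X⟧` is the completed tensor square of `(U M)⟦X⟧` over `ℂ⟦X⟧`. -/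

/-- `x ↦ x ⊗ 1`. -/
noncomputable def inLeft (M : ℕ) : (U M)⟦X⟧ →+* (U M ⊗[ℂ] U M)⟦X⟧ :=
  PowerSeries.map (Algebra.TensorProduct.includeLeft : U M →ₐ[ℂ] U M ⊗[ℂ] U M).toRingHom

/-- `x ↦ 1 ⊗ x`. -/
noncomputable def inRight (M : ℕ) : (U M)⟦X⟧ →+* (U M ⊗[ℂ] U M)⟦X⟧ :=
  PowerSeries.map (Algebra.TensorProduct.includeRight : U M →ₐ[ℂ] U M ⊗[ℂ] U M).toRingHom

/-! ### Invariants and the extended Jordanian twist -/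

/-- The rank `N` of `g_k = so(M-4k)`, so that `M - 4k` is `2N` or `2N+1`. -/
def rk (M k : ℕ) : ℕ := (M - 4 * k) / 2

/-- `I^a_{M-4k} = ½ E_a² + ∑_{l=3}^N E_{a+l} E_{a-l}`, the first term only for odd `M`. -/
noncomputable def inv (M k a : ℕ) : U M :=
  (if Odd M then (1 / 2 : ℂ) • inU M (rootShort M k a) ^ 2 else 0) +
    ∑ l ∈ Finset.Icc 3 (rk M k), inU M (rootPlus M k a l) * inU M (rootMinus M k a l)

/-- `I^{a⊗b}_{M-4k} = E_a ⊗ E_b + ∑_{l=3}^N (E_{a+l} ⊗ E_{b-l} + E_{a-l} ⊗ E_{b+l})`, the first term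
only for odd `M`. -/
noncomputable def invTensor (M k a b : ℕ) : U M ⊗[ℂ] U M :=
  (if Odd M then inU M (rootShort M k a) ⊗ₜ[ℂ] inU M (rootShort M k b) else 0) +
    ∑ l ∈ Finset.Icc 3 (rk M k),
      (inU M (rootPlus M k a l) ⊗ₜ[ℂ] inU M (rootMinus M k b l) +
        inU M (rootMinus M k a l) ⊗ₜ[ℂ] inU M (rootPlus M k b l))

/-- `σ = ln (1 + η E_{1+2})`. -/
noncomputable def sigma (M k : ℕ) : (U M)⟦X⟧ := flog (eta * const (inU M (rootInit M k)))

/-- The Jordanian factor `exp (H_{1+2} ⊗ σ)`. -/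
noncomputable def jordanian (M k : ℕ) : (U M ⊗[ℂ] U M)⟦X⟧ :=
  fexp (inLeft M (const (inU M (cartanPlus M k))) * inRight M (sigma M k))

/-- The extension factor `exp (η I^{1⊗2} (1 ⊗ e^{-σ/2}))`. It is the product of the pairwise
commuting factors `exp (η E_λ' ⊗ E_{λ₀-λ'} e^{-σ/2})`, where `λ₀ = e_1 + e_2` and `λ'` runs over the
constituent roots `e_1 ± e_l` and (for odd `M`) `e_1`. -/
noncomputable def extension (M k : ℕ) : (U M ⊗[ℂ] U M)⟦X⟧ :=
  fexp (eta * const (invTensor M k 1 2) * inRight M (fexp (-(1 / 2 : ℂ) • sigma M k)))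

/-- The extended Jordanian twist on the initial root `e_1 + e_2` of `g_k`. -/
noncomputable def twist (M k : ℕ) : (U M ⊗[ℂ] U M)⟦X⟧ := extension M k * jordanian M k

/-- The twisted coproduct `Δ_F(x) = F Δ(x) F⁻¹`. -/
noncomputable def twistedComul (M k : ℕ) (x : (U M)⟦X⟧) : (U M ⊗[ℂ] U M)⟦X⟧ :=
  twist M k * PowerSeries.map (comul M).toRingHom x * Ring.inverse (twist M k)

/-- `x` is primitive for the twisted coproduct. -/
def IsTwistedPrimitive (M k : ℕ) (x : (U M)⟦X⟧) : Prop :=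
  twistedComul M k x = inLeft M x + inRight M x

/-- `G_{1-2} = E_{1-2} - η I^1`. -/
noncomputable def gen12 (M k : ℕ) : (U M)⟦X⟧ :=
  const (inU M (root12 M k)) - eta * const (inv M k 1)

/-- `G_{2-1} = E_{2-1} - η I^2 e^{-σ}`. -/
noncomputable def gen21 (M k : ℕ) : (U M)⟦X⟧ :=
  const (inU M (root21 M k)) - eta * const (inv M k 2) * fexp (-sigma M k)

/-- `H_{1-2}`, as an element of `U(so(M))⟦η⟧`. -/
noncomputable def genH (M k : ℕ) : (U M)⟦X⟧ := const (inU M (cartanMinus M k))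

/-- The inclusion of `g_{k+1} = so(M-4(k+1))` into `U(so(M))⟦η⟧`. -/
noncomputable def gNextIncl (M k : ℕ) : so (Fin (M - 4 * (k + 1))) ℂ →ₗ⁅ℂ⁆ (U M)⟦X⟧ :=
  (const (A := U M)).toLieHom.comp ((inU M).comp (soIncl M (4 * (k + 1))))

/-- The space `V(g_{k+1})`. -/
noncomputable def gNext (M k : ℕ) : LieSubalgebra ℂ (U M)⟦X⟧ := (gNextIncl M k).range

end FullChain

/-! Write `ε_q` for the coordinate vectors of the space on which `g_{k+1}` acts. The tensor `∑ ε_q ⊗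
ε_q` equals `∑ (v_l ⊗ v_{-l} + v_{-l} ⊗ v_l)`, plus `v_0 ⊗ v_0` for odd `M`
(`sum_isotropic_eq_sum_orthonormal`). With `a_q = v_1 ∧ ε_q` and `b_q = v_2 ∧ ε_q`, both parities
therefore give `I^1 = ½ ∑ a_q²`, `I^2 = ½ ∑ b_q²`, `I^{1⊗2} = ∑ a_q ⊗ b_q`. The twist then only sees
the relations collected in `CarrierRelations`: `a`, `b` form a Heisenberg algebra with central `e =
E_{1+2}`, the elements `x = E_{1-2}` and `y = E_{2-1}` exchange `a` and `b`, and `t = H_{1+2}` is a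
grading.

Conjugation by either factor of `F` is explicit. The Jordanian factor multiplies `z ⊗ 1` by `e^{cσ}`
when `z` has `t`-weight `c`. The exponent `f` of the extension satisfies `(ad f)³ = 0` on everything
needed, so conjugation by `e^f` is `1 + ad f + ½ (ad f)²` (`fexp_semiconjBy`). This yields `Δ_F a =
a ⊗ e^{-σ/2} + 1 ⊗ a` and `Δ_F b = b ⊗ e^{σ/2} + (1 + ηe) ⊗ b`, and makes `1 + ηe = e^σ` group-like.
The non-primitive part of `Δ_F x` is a cross term `a ⊗ a` and a quadratic term; squaring `Δ_F a` in
`η I^1` produces the same ones, and they cancel in `G_{1-2}`. The same happens with `y`, `b` and `η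
I^2 e^{-σ}` in `G_{2-1}` (`extendedTwist_x`, `extendedTwist_y`).

For the bracket of `G_{1-2}` and `G_{2-1}`, all corrections are multiples of the one element `K = ½
∑ (a_q b_q + b_q a_q)` and sum to `ηK((1 + ηe)e^{-σ} - 1) = 0` (`bracket_deformed_generators`). The
algebra `g_{k+1}` kills `v_1, v_2` and rotates the `ε_q` by skew matrices, so it fixes all these
contractions; this gives both its primitivity and its commuting with `so_G(3)`. Injectivity and
directness of the sum are checked at `η = 0`, where they concern matrices in `so(M)`
(`eq_zero_of_gNextIncl_add_soG`). -/

namespace FullChain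

/-! ### Commutation with truncated exponentials. -/

section ExpSum

open Finset
open scoped Nat

variable {R : Type} [Ring R] [Algebra ℂ R]

/-- The partial sums of the exponential series. -/
noncomputable def expSum (N : ℕ) (f : R) : R :=
  ∑ j ∈ range N, ((j ! : ℂ)⁻¹) • f ^ j

/-- Here `(ad f)³ z = 0`, so the binomial expansion of `f ^ n * z` stops after three terms. Writing
`n = j + 2` keeps all exponents free of truncated subtraction. -/
theorem pow_mul_of_commutators {f z c d : R} (hc : f * z = z * f + c)
    (hd : f * c = c * f + d) (h : Commute f d) (j : ℕ) :
    f ^ (j + 2) * z = z * f ^ (j + 2) + ((j + 2 : ℕ) : ℂ) • (c * f ^ (j + 1)) +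
      (((j + 2).choose 2 : ℕ) : ℂ) • (d * f ^ j) := by
  induction j with
  | zero =>
    have : f ^ 2 * z = z * f ^ 2 + c * f + c * f + d := by
      rw [pow_two, mul_assoc, hc, mul_add, hd, ← mul_assoc, hc]; noncomm_ring
    simp only [zero_add, this, pow_one, pow_zero, mul_one, Nat.choose_self, Nat.cast_one, one_smul,
      Nat.cast_ofNat, two_smul]
    abel
  | succ j ih =>
    have e1 : f ^ (j + 1 + 2) * z = f * (f ^ (j + 2) * z) := by rw [← mul_assoc, ← pow_succ']
    rw [e1, ih, mul_add, mul_add, mul_smul_comm, mul_smul_comm, ← mul_assoc, ← mul_assoc,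
      ← mul_assoc, hc, hd, h.eq, add_mul, add_mul, mul_assoc, mul_assoc, mul_assoc, ← pow_succ',
      ← pow_succ', ← pow_succ']
    have e2 : (j + 1 + 2).choose 2 = (j + 2).choose 2 + (j + 2) := by
      rw [show j + 1 + 2 = (j + 2) + 1 from rfl, Nat.choose_succ_succ', Nat.choose_one_right]; ring
    rw [e2]
    push_cast
    simp only [smul_add, add_smul, one_smul, show j + 2 + 1 = j + 1 + 2 from rfl,
      show j + 1 + 1 = j + 2 from rfl]
    abel

/-- Since `n / n! = 1 / (n-1)!` and `choose n 2 / n! = ½ / (n-2)!`, each commutator shortens the sum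
by one term. With the lengths `N + 2`, `N + 1`, `N` the identity is exact, with no remainder. -/
theorem expSum_mul {f z c d : R} (hc : f * z = z * f + c) (hd : f * c = c * f + d)
    (h : Commute f d) (N : ℕ) : expSum (N + 2) f * z =
      z * expSum (N + 2) f + c * expSum (N + 1) f + ((1 / 2 : ℂ) • d) * expSum N f := by
  have h0 : (expSum (0 + 2) f : R) = 1 + f := by simp [expSum, sum_range_succ]
  induction N with
  | zero =>
    have h1 : (expSum (0 + 1) f : R) = 1 := by simp [expSum]
    have h2 : (expSum 0 f : R) = 0 := by simp [expSum]
    rw [h0, h1, h2, add_mul, hc]; noncomm_ring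
  | succ N ih =>
    have e (n : ℕ) : (expSum (n + 1) f : R) = expSum n f + ((n ! : ℂ)⁻¹) • f ^ n :=
      sum_range_succ _ _
    rw [show N + 1 + 2 = N + 2 + 1 from rfl, e (N + 2), add_mul, ih, smul_mul_assoc _ (f ^ (N + 2)) z,
      pow_mul_of_commutators hc hd h, e (N + 1), e N]
    have h1 : (((N + 2) ! : ℕ) : ℂ)⁻¹ * ((N + 2 : ℕ) : ℂ) = (((N + 1) ! : ℕ) : ℂ)⁻¹ := by
      rw [Nat.factorial_succ (N + 1)]
      have := Nat.factorial_ne_zero (N + 1)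
      have : ((N + 1 + 1 : ℕ) : ℂ) ≠ 0 := Nat.cast_ne_zero.2 (by omega)
      push_cast at *
      field_simp
      ring
    have h2 : (((N + 2) ! : ℕ) : ℂ)⁻¹ * (((N + 2).choose 2 : ℕ) : ℂ) =
        ((N ! : ℕ) : ℂ)⁻¹ * (1 / 2) := by
      have h3 : ((((N + 2).choose 2 : ℕ)) : ℂ) * (N ! * 2) = ((N + 2) ! : ℕ) := by
        rw [← Nat.add_choose_mul_factorial_mul_factorial]
        push_cast [Nat.factorial_two]; ring
      have := Nat.factorial_ne_zero N
      have := Nat.factorial_ne_zero (N + 2)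
      field_simp
      linear_combination h3
    simp only [smul_add, smul_smul, h1, h2, mul_add, mul_smul_comm, smul_mul_assoc]
    abel

end ExpSum

/-! ### Exponentials and other series in a noncommutative `A⟦X⟧`. -/

section FormalComposition

open PowerSeries Finset
open scoped Nat

variable {A : Type} [Ring A]

theorem X_pow_dvd_pow {f : A⟦X⟧} (hf : constantCoeff f = 0) (j : ℕ) :
    (X : A⟦X⟧) ^ j ∣ f ^ j := by
  obtain ⟨g, rfl⟩ := X_dvd_iff.2 hf
  rw [(commute_X g).symm.mul_pow]
  exact dvd_mul_right _ _

theorem coeff_mul_eq_zero_of_X_pow_dvd {a b : A⟦X⟧} {i j n : ℕ} (ha : (X : A⟦X⟧) ^ i ∣ a)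
    (hb : (X : A⟦X⟧) ^ j ∣ b) (h : n < i + j) : coeff n (a * b) = 0 := by
  obtain ⟨a, rfl⟩ := ha
  obtain ⟨b, rfl⟩ := hb
  rw [mul_assoc, ← mul_assoc a, (commute_X_pow a j).eq, mul_assoc, ← mul_assoc, ← pow_add,
    coeff_X_pow_mul', if_neg (by omega)]

theorem coeff_mul_congr {a a' b b' : A⟦X⟧} {n : ℕ} (ha : ∀ m ≤ n, coeff m a = coeff m a')
    (hb : ∀ m ≤ n, coeff m b = coeff m b') : coeff n (a * b) = coeff n (a' * b') := by
  rw [coeff_mul, coeff_mul]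
  refine sum_congr rfl fun p hp => ?_
  have := mem_antidiagonal.1 hp
  rw [ha _ (by omega), hb _ (by omega)]

variable [Algebra ℂ A]

/-- Powers `f ^ j` with `j > n` do not reach degree `n`, so any sufficiently long truncation
computes the coefficient. The freedom in `N` lets partial sums of different lengths be compared. -/
theorem coeff_compSeries {f : A⟦X⟧} (hf : constantCoeff f = 0) (u : ℂ⟦X⟧) {n N : ℕ} (h : n < N) :
    coeff n (compSeries u f) = coeff n (∑ j ∈ range N, coeff j u • f ^ j) := by
  rw [compSeries, coeff_mk, map_sum]
  simp only [coeff_smul]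
  refine sum_subset (range_subset_range.2 h) fun j _ hj => ?_
  have := coeff_mul_eq_zero_of_X_pow_dvd (n := n) (X_pow_dvd_pow hf j)
    (b := 1) (j := 0) (by simp) (by simpa using hj)
  rw [← mul_one (f ^ j), this, smul_zero]

theorem coeff_fexp {f : A⟦X⟧} (hf : constantCoeff f = 0) {n N : ℕ} (h : n < N) :
    coeff n (fexp f) = coeff n (expSum N f) := by
  rw [fexp, coeff_compSeries hf _ h, expSum]
  simp [coeff_exp]

theorem constantCoeff_fexp {f : A⟦X⟧} : constantCoeff (fexp f) = 1 := by
  rw [← coeff_zero_eq_constantCoeff_apply, fexp, compSeries, coeff_mk]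
  simp

theorem constantCoeff_flog {f : A⟦X⟧} : constantCoeff (flog f) = 0 := by
  rw [← coeff_zero_eq_constantCoeff_apply, flog, compSeries, coeff_mk]
  simp

theorem fexp_zero : fexp (0 : A⟦X⟧) = 1 := by
  ext n
  rw [coeff_fexp (by simp) (Nat.lt_succ_self n), expSum, sum_range_succ']
  simp

/-- Passes from the triangle `i + j < N`, natural for the exponential of a sum, to the square,
natural for a product of partial sums. -/
theorem sum_antidiagonal_range {β : Type*} [AddCommMonoid β] (F : ℕ → ℕ → β) (N : ℕ)
    (hF : ∀ i j, N ≤ i + j → F i j = 0) :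
    ∑ m ∈ range N, ∑ p ∈ antidiagonal m, F p.1 p.2 = ∑ i ∈ range N, ∑ j ∈ range N, F i j := by
  rw [sum_sigma', ← sum_product']
  refine sum_of_injOn (fun x => x.2) ?_ ?_ ?_ ?_
  · rintro ⟨m, p⟩ hp ⟨m', p'⟩ hp' h
    simp only [coe_sigma, Set.mem_sigma_iff, SetLike.mem_coe, HasAntidiagonal.mem_antidiagonal] at hp hp'
    obtain rfl : p = p' := h
    obtain rfl : m = m' := by omega
    rfl
  · rintro ⟨m, p⟩ hp
    simp only [coe_sigma, Set.mem_sigma_iff, SetLike.mem_coe, HasAntidiagonal.mem_antidiagonal, mem_range] at hp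
    simp only [SetLike.mem_coe, mem_product, mem_range]
    omega
  · rintro ⟨i, j⟩ _ h
    refine hF i j ?_
    by_contra hlt
    exact h ⟨⟨i + j, (i, j)⟩, by simp; omega, rfl⟩
  · intros; rfl

theorem inv_factorial_smul_add_pow {f g : A⟦X⟧} (h : Commute f g) (m : ℕ) :
    ((m ! : ℂ)⁻¹) • (f + g) ^ m =
      ∑ p ∈ antidiagonal m, (((p.1 ! : ℂ)⁻¹) • f ^ p.1) * (((p.2 ! : ℂ)⁻¹) • g ^ p.2) := by
  rw [h.add_pow', smul_sum]
  refine sum_congr rfl fun p hp => ?_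
  rw [smul_mul_smul_comm, ← Nat.cast_smul_eq_nsmul ℂ, smul_smul]
  congr 1
  have := mem_antidiagonal.1 hp
  subst this
  have h1 := Nat.factorial_ne_zero p.1
  have h2 := Nat.factorial_ne_zero p.2
  have h3 := Nat.factorial_ne_zero (p.1 + p.2)
  have h4 : (((p.1 + p.2).choose p.1 : ℕ) : ℂ) * (p.1 ! * p.2 !) = ((p.1 + p.2) ! : ℕ) := by
    rw [← Nat.add_choose_mul_factorial_mul_factorial, Nat.choose_symm_add]; push_cast; ring
  field_simp
  linear_combination h4

theorem fexp_add {f g : A⟦X⟧} (hf : constantCoeff f = 0) (hg : constantCoeff g = 0)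
    (h : Commute f g) : fexp (f + g) = fexp f * fexp g := by
  ext n
  rw [coeff_fexp (by simp [hf, hg]) (Nat.lt_succ_self n),
    coeff_mul_congr (a' := expSum (n + 1) f) (b' := expSum (n + 1) g)
      (fun m hm => coeff_fexp hf (by omega)) (fun m hm => coeff_fexp hg (by omega))]
  simp only [expSum, inv_factorial_smul_add_pow h, sum_mul_sum, map_sum]
  refine sum_antidiagonal_range
    (fun i j => coeff n ((((i ! : ℂ)⁻¹) • f ^ i) * (((j ! : ℂ)⁻¹) • g ^ j))) (n + 1) fun i j hij => ?_
  rw [smul_mul_smul_comm, coeff_smul,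
    coeff_mul_eq_zero_of_X_pow_dvd (X_pow_dvd_pow hf i) (X_pow_dvd_pow hg j) (by omega), smul_zero]

theorem fexp_mul_fexp_neg {f : A⟦X⟧} (hf : constantCoeff f = 0) : fexp f * fexp (-f) = 1 := by
  rw [← fexp_add hf (by simp [hf]) (Commute.neg_right rfl), add_neg_cancel, fexp_zero]

theorem fexp_neg_mul_fexp {f : A⟦X⟧} (hf : constantCoeff f = 0) : fexp (-f) * fexp f = 1 := by
  simpa using fexp_mul_fexp_neg (f := -f) (by simp [hf])

theorem isUnit_fexp {f : A⟦X⟧} (hf : constantCoeff f = 0) : IsUnit (fexp f) :=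
  ⟨⟨fexp f, fexp (-f), fexp_mul_fexp_neg hf, fexp_neg_mul_fexp hf⟩, rfl⟩

theorem map_compSeries {B : Type} [Ring B] [Algebra ℂ B] (θ : A →ₐ[ℂ] B) (u : ℂ⟦X⟧) (f : A⟦X⟧) :
    PowerSeries.map θ.toRingHom (compSeries u f) =
      compSeries u (PowerSeries.map θ.toRingHom f) := by
  ext n
  simp only [compSeries, coeff_map, coeff_mk, ← map_pow]
  simp

/-- If `f z = w f` then the same relation holds for every power series in `f`. -/
theorem compSeries_mul_eq {f g z : A⟦X⟧} (hf : constantCoeff f = 0) (hg : constantCoeff g = 0)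
    (u : ℂ⟦X⟧) (h : SemiconjBy z g f) : compSeries u f * z = z * compSeries u g := by
  ext n
  rw [coeff_mul_congr (a' := ∑ j ∈ range (n + 1), coeff j u • f ^ j) (b' := z)
      (fun m hm => coeff_compSeries hf u (by omega)) (fun _ _ => rfl),
    coeff_mul_congr (a := z) (a' := z) (b' := ∑ j ∈ range (n + 1), coeff j u • g ^ j)
      (fun _ _ => rfl) (fun m hm => coeff_compSeries hg u (by omega))]
  congr 1
  rw [sum_mul, mul_sum]
  refine sum_congr rfl fun j _ => ?_
  rw [smul_mul_assoc, mul_smul_comm, (h.pow_right j).eq]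

theorem commute_compSeries {f z : A⟦X⟧} (hf : constantCoeff f = 0) (u : ℂ⟦X⟧) (h : Commute f z) :
    Commute (compSeries u f) z :=
  compSeries_mul_eq hf hf u h.symm

/-- This is `e^f z e^{-f} = e^{ad f} z` when the adjoint series ends at second order, phrased
without inverses. -/
theorem fexp_semiconjBy {f z c d : A⟦X⟧} (hf : constantCoeff f = 0) (hc : f * z = z * f + c)
    (hd : f * c = c * f + d) (h : Commute f d) :
    SemiconjBy (fexp f) z (z + c + (1 / 2 : ℂ) • d) := by
  refine PowerSeries.ext fun n => ?_
  -- With length `n + 3`, the sums of lengths `n + 2` and `n + 1` left by `expSum_mul` still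
  -- determine degree `n`.
  rw [coeff_mul_congr (a' := expSum (n + 1 + 2) f) (b' := z)
      (fun m hm => coeff_fexp hf (by omega)) (fun _ _ => rfl), expSum_mul hc hd h, add_mul, add_mul,
      map_add, map_add, map_add, map_add]
  congr 1
  · congr 1
    all_goals exact coeff_mul_congr (fun _ _ => rfl) (fun m hm => (coeff_fexp hf (by omega)).symm)
  · exact coeff_mul_congr (fun _ _ => rfl) (fun m hm => (coeff_fexp hf (by omega)).symm)

end FormalComposition

end FullChain

namespace FullChain

/-! ### Substituting `η x` into scalar series; `exp` of `ln`. -/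

section SubstituteConstant

open PowerSeries Finset
open scoped Nat

variable {A : Type} [Ring A]

theorem commute_eta (x : A⟦X⟧) : Commute eta x := (commute_X x).symm

variable [Algebra ℂ A]

theorem commute_const {x y : A} (h : Commute x y) : Commute (const x) (const y) := h.map const

theorem coeff_const (n : ℕ) (x : A) : coeff n (const x) = if n = 0 then x else 0 := coeff_C n x

theorem coeff_eta_mul_const_pow (n j : ℕ) (x : A) :
    coeff n ((eta * const x) ^ j) = if n = j then x ^ j else 0 := by
  rw [(commute_eta _).mul_pow, ← map_pow, eta, coeff_X_pow_mul', coeff_const]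
  by_cases h : n = j
  · simp [h]
  · by_cases h' : j ≤ n
    · rw [if_pos h', if_neg (by omega), if_neg h]
    · rw [if_neg h', if_neg h]

theorem coeff_compSeries_eta_mul_const (u : ℂ⟦X⟧) (x : A) (n : ℕ) :
    coeff n (compSeries u (eta * const x)) = coeff n u • x ^ n := by
  rw [compSeries, coeff_mk]
  simp only [coeff_eta_mul_const_pow]
  rw [sum_eq_single n] <;> simp +contextual [eq_comm]

/-- Substitution of `η x` into complex power series, for a constant `x`. -/
noncomputable def substConst (x : A) : ℂ⟦X⟧ →ₐ[ℂ] A⟦X⟧ :=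
  AlgHom.ofLinearMap
    { toFun := fun u => compSeries u (eta * const x)
      map_add' := fun u v => by ext n; simp [coeff_compSeries_eta_mul_const, add_smul]
      map_smul' := fun c u => by ext n; simp [coeff_compSeries_eta_mul_const, mul_smul] }
    (by
      ext n
      simp only [LinearMap.coe_mk, AddHom.coe_mk, coeff_compSeries_eta_mul_const, coeff_one]
      split_ifs with h <;> simp [h])
    fun u v => by
      ext n
      simp only [LinearMap.coe_mk, AddHom.coe_mk, coeff_compSeries_eta_mul_const, coeff_mul,
        sum_smul]
      refine sum_congr rfl fun p hp => ?_
      rw [smul_mul_smul_comm, ← pow_add, HasAntidiagonal.mem_antidiagonal.1 hp]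

theorem coeff_substConst (x : A) (u : ℂ⟦X⟧) (n : ℕ) :
    coeff n (substConst x u) = coeff n u • x ^ n :=
  coeff_compSeries_eta_mul_const u x n

theorem substConst_X (x : A) : substConst x X = eta * const x := by
  ext n
  rw [coeff_substConst, ← pow_one (eta * const x), coeff_eta_mul_const_pow, coeff_X]
  split_ifs with h <;> simp [h]

/-- Carries identities between compositions of scalar series, such as `exp (log (1 + X)) = 1 + X`,
over to `A⟦X⟧`. -/
theorem compSeries_substConst (x : A) (u v : ℂ⟦X⟧) :
    compSeries u (substConst x v) = substConst x (compSeries u v) := by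
  ext n
  simp only [coeff_substConst, compSeries, coeff_mk, sum_smul, ← map_pow]
  simp [mul_smul]

theorem derivative_fexp {f : ℂ⟦X⟧} (hf : constantCoeff f = 0) :
    derivative ℂ (fexp f) = derivative ℂ f * fexp f := by
  have h (N : ℕ) : derivative ℂ (expSum (N + 1) f) = derivative ℂ f * expSum N f := by
    have hs (c : ℂ) (g : ℂ⟦X⟧) : derivative ℂ (c • g) = c • derivative ℂ g := by
      ext n; simp [coeff_derivative]
    rw [expSum, expSum, sum_range_succ', map_add, map_sum, mul_sum]
    simp only [pow_zero, hs, derivative_one, smul_zero, add_zero, derivative_pow]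
    refine sum_congr rfl fun j _ => ?_
    have := Nat.factorial_ne_zero j
    have h1 : ((j + 1 : ℕ) : ℂ) ≠ 0 := Nat.cast_ne_zero.2 (by omega)
    have h2 : (((j + 1) ! : ℕ) : ℂ)⁻¹ * ((j + 1 : ℕ) : ℂ) = ((j ! : ℕ) : ℂ)⁻¹ := by
      rw [Nat.factorial_succ]
      push_cast at *
      field_simp
    rw [← h2, mul_smul, Nat.cast_smul_eq_nsmul ℂ, nsmul_eq_mul, Nat.add_sub_cancel, mul_smul_comm]
    congr 1
    ring
  ext n
  -- Differentiation reads the coefficient of degree `n + 1`, hence the truncation at `n + 2`.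
  rw [coeff_derivative, coeff_fexp hf (N := n + 2) (by omega), ← coeff_derivative, h]
  exact coeff_mul_congr (fun _ _ => rfl) fun m hm => (coeff_fexp hf (by omega)).symm

/-- With `G = log'` one has `(1 + X) G = 1`, hence `G' = -G²`. So `exp(log) · G` has derivative zero
and constant term `1`, which makes `exp(log)` the inverse of `G`. -/
theorem fexp_log : fexp (log ℂ) = 1 + X := by
  set G : ℂ⟦X⟧ := derivative ℂ (log ℂ) with hG
  have h1 : (1 + X) * G = 1 := by
    ext n
    rw [hG, deriv_log, add_mul, one_mul, map_add]
    cases n with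
    | zero => simp
    | succ n => simp [coeff_succ_X_mul, coeff_one, pow_succ]
  have h2 : G ^ 2 + derivative ℂ G = 0 := by
    have h3 := congrArg (derivative ℂ) h1
    rw [Derivation.leibniz, map_add, derivative_one, derivative_X, smul_eq_mul, smul_eq_mul] at h3
    linear_combination G * h3 - derivative ℂ G * h1
  have h4 : fexp (log ℂ) * G = 1 := by
    apply derivative.ext
    · rw [Derivation.leibniz, derivative_fexp constantCoeff_log, derivative_one, smul_eq_mul,
        smul_eq_mul, ← hG]
      linear_combination fexp (log ℂ) * h2
    · rw [map_mul, constantCoeff_fexp, hG, deriv_log]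
      simp [← coeff_zero_eq_constantCoeff_apply]
  linear_combination (1 + X) * h4 - fexp (log ℂ) * h1

theorem flog_eta_mul_const (x : A) : flog (eta * const x) = substConst x (log ℂ) := rfl

theorem fexp_flog (x : A) : fexp (flog (eta * const x)) = 1 + eta * const x := by
  rw [flog_eta_mul_const, fexp, compSeries_substConst, ← fexp, fexp_log, map_add, map_one,
    substConst_X]

end SubstituteConstant

end FullChain

/-! ### The abstract twist: conjugation by each of its two factors. -/

namespace FullChain

open PowerSeries Finset

/-- The commutation relations between the Cartan element `t = H_{1+2}` and the root vectors
`e = E_{1+2}`, `x = E_{1-2}`, `y = E_{2-1}`, `a q = v_1 ∧ ε_q`, `b q = v_2 ∧ ε_q`, where the `ε_q`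
are orthonormal. -/
structure CarrierRelations {ι R : Type} [DecidableEq ι] [Ring R] [Algebra ℂ R] (t e x y : R)
    (a b : ι → R) : Prop where
  a_b : ∀ q r, a q * b r = b r * a q + if q = r then e else 0
  a_a : ∀ q r, Commute (a q) (a r)
  b_b : ∀ q r, Commute (b q) (b r)
  e_a : ∀ q, Commute e (a q)
  e_b : ∀ q, Commute e (b q)
  e_x : Commute e x
  e_y : Commute e y
  x_a : ∀ q, Commute x (a q)
  y_b : ∀ q, Commute y (b q)
  b_x : ∀ q, b q * x = x * b q + a q
  a_y : ∀ q, a q * y = y * a q + b q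
  t_e : t * e = e * t + e
  t_a : ∀ q, t * a q = a q * t + (1 / 2 : ℂ) • a q
  t_b : ∀ q, t * b q = b q * t + (1 / 2 : ℂ) • b q
  t_x : Commute t x
  t_y : Commute t y

theorem CarrierRelations.map {ι R S : Type} [DecidableEq ι] [Ring R] [Algebra ℂ R] [Ring S]
    [Algebra ℂ S] {t e x y : R} {a b : ι → R} (h : CarrierRelations t e x y a b) (θ : R →ₐ[ℂ] S) :
    CarrierRelations (θ t) (θ e) (θ x) (θ y) (fun q => θ (a q)) (fun q => θ (b q)) where
  a_b q r := by
    rw [← map_mul, h.a_b, map_add, map_mul]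
    split_ifs <;> simp
  a_a q r := (h.a_a q r).map θ
  b_b q r := (h.b_b q r).map θ
  e_a q := (h.e_a q).map θ
  e_b q := (h.e_b q).map θ
  e_x := h.e_x.map θ
  e_y := h.e_y.map θ
  x_a q := (h.x_a q).map θ
  y_b q := (h.y_b q).map θ
  b_x q := by rw [← map_mul, h.b_x, map_add, map_mul]
  a_y q := by rw [← map_mul, h.a_y, map_add, map_mul]
  t_e := by rw [← map_mul, h.t_e, map_add, map_mul]
  t_a q := by rw [← map_mul, h.t_a, map_add, map_mul, map_smul]
  t_b q := by rw [← map_mul, h.t_b, map_add, map_mul, map_smul]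
  t_x := h.t_x.map θ
  t_y := h.t_y.map θ

/-- Two commuting copies `L`, `R` of an algebra containing the carrier, in an algebra of formal power
series, together with a logarithm `s` of `1 + η R(e)`. -/
structure TwistSetting {ι U W : Type} [DecidableEq ι] [Ring U] [Algebra ℂ U] [Ring W] [Algebra ℂ W]
    (L R : U →ₐ[ℂ] W⟦X⟧) (s : W⟦X⟧) (t e x y : U) (a b : ι → U) : Prop where
  rel : CarrierRelations t e x y a b
  comm : ∀ u v, Commute (L u) (R v)
  constantCoeff_s : constantCoeff s = 0
  fexp_s : fexp s = 1 + eta * R e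
  comm_s : ∀ z, Commute (R e) z → Commute s z

namespace TwistSetting

section Jordanian

variable {A : Type} [Ring A] [Algebra ℂ A]

/-- From `τ z = z (τ + c)` follows `(τ s) z = z (τ s + c s)`, so the exponential of `τ s` passes `z`
and picks up `e^{c s}`. -/
theorem fexp_mul_semiconjBy {τ s z : A⟦X⟧} {c : ℂ} (hs : constantCoeff s = 0) (hτ : Commute τ s)
    (hz : Commute s z) (h : τ * z = z * τ + c • z) :
    SemiconjBy (fexp (τ * s)) z (z * fexp (c • s)) := by
  have h0 : constantCoeff (τ * s) = 0 := by simp [hs]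
  have h1 : constantCoeff (c • s) = 0 := by
    rw [← coeff_zero_eq_constantCoeff_apply, coeff_smul, coeff_zero_eq_constantCoeff_apply, hs,
      smul_zero]
  have h2 : Commute (c • s) (τ * s) := (hτ.symm.mul_right rfl).smul_left c
  rw [SemiconjBy, mul_assoc, ← fexp_add h1 h0 h2]
  refine compSeries_mul_eq h0 (by simp [h0, h1]) _ ?_
  rw [SemiconjBy, mul_assoc τ, hz.eq, ← mul_assoc, h, add_mul, mul_add, add_comm, smul_mul_assoc,
    mul_smul_comm, mul_assoc]

end Jordanian

section ExtensionFactor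

variable {ι U W : Type} [Fintype ι] [Ring U] [Algebra ℂ U] [Ring W] [Algebra ℂ W]
  {L R : U →ₐ[ℂ] W⟦X⟧} {s : W⟦X⟧} {a b : ι → U}

variable (L R s a b) in
/-- The exponent of the extension factor of the twist. -/
noncomputable def extExponent : W⟦X⟧ :=
  eta * (∑ q, L (a q) * R (b q)) * fexp (-(1 / 2 : ℂ) • s)

theorem constantCoeff_extExponent : constantCoeff (extExponent L R s a b) = 0 := by
  simp [extExponent, eta]

theorem extExponent_mul {z : W⟦X⟧} {c : ι → W⟦X⟧}
    (hz : Commute (fexp (-(1 / 2 : ℂ) • s)) z)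
    (hc : ∀ q, L (a q) * R (b q) * z = z * (L (a q) * R (b q)) + c q) :
    extExponent L R s a b * z =
      z * extExponent L R s a b + eta * (∑ q, c q) * fexp (-(1 / 2 : ℂ) • s) := by
  rw [extExponent, mul_assoc, hz.eq, ← mul_assoc, mul_assoc eta _ z, sum_mul, sum_congr rfl fun q _ => hc q,
    sum_add_distrib, mul_add, add_mul, ← mul_sum, ← mul_assoc, ← mul_assoc, ← mul_assoc,
    (commute_eta z).eq]

theorem commute_extExponent {z : W⟦X⟧} (hz : Commute (fexp (-(1 / 2 : ℂ) • s)) z)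
    (hL : ∀ q, Commute (L (a q)) z) (hR : ∀ q, Commute (R (b q)) z) :
    Commute (extExponent L R s a b) z :=
  ((commute_eta z).mul_left (Commute.sum_left _ _ _ fun q _ => (hL q).mul_left (hR q))).mul_left hz

theorem extension_commute {z : W⟦X⟧} (hz : Commute (extExponent L R s a b) z) :
    SemiconjBy (fexp (extExponent L R s a b)) z z :=
  commute_compSeries constantCoeff_extExponent _ hz

/-- For second commutators: a first commutator with the exponent again has the shape `η (∑ z_q)
e^{-s/2}`, so it suffices to commute past each `z_q`. -/
theorem extExponent_mul_sum {z c : ι → W⟦X⟧}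
    (hs : Commute (extExponent L R s a b) (fexp (-(1 / 2 : ℂ) • s)))
    (hc : ∀ q, extExponent L R s a b * z q = z q * extExponent L R s a b + c q) :
    extExponent L R s a b * (eta * (∑ q, z q) * fexp (-(1 / 2 : ℂ) • s)) =
      eta * (∑ q, z q) * fexp (-(1 / 2 : ℂ) • s) * extExponent L R s a b +
        eta * (∑ q, c q) * fexp (-(1 / 2 : ℂ) • s) := by
  rw [← mul_assoc, ← mul_assoc, ← (commute_eta _).eq, mul_assoc eta, mul_sum,
    sum_congr rfl fun q _ => hc q, sum_add_distrib, ← sum_mul, mul_add, add_mul, ← mul_assoc eta,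
    mul_assoc _ (extExponent L R s a b), hs.eq, ← mul_assoc]

end ExtensionFactor

section Conjugation

variable {ι U W : Type} [DecidableEq ι] [Ring U] [Algebra ℂ U] [Ring W] [Algebra ℂ W]
  {L R : U →ₐ[ℂ] W⟦X⟧} {s : W⟦X⟧} {t e x y : U} {a b : ι → U}

theorem constantCoeff_smul_s (h : TwistSetting L R s t e x y a b) (c : ℂ) :
    constantCoeff (c • s) = 0 := by
  rw [← coeff_zero_eq_constantCoeff_apply, coeff_smul, coeff_zero_eq_constantCoeff_apply,
    h.constantCoeff_s, smul_zero]

theorem commute_fexp (h : TwistSetting L R s t e x y a b) (c : ℂ) {z : W⟦X⟧}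
    (hz : Commute (R e) z) : Commute (fexp (c • s)) z :=
  commute_compSeries (h.constantCoeff_smul_s c) _ ((h.comm_s z hz).smul_left c)

theorem fexp_mul_fexp (h : TwistSetting L R s t e x y a b) (c d : ℂ) :
    fexp (c • s) * fexp (d • s) = fexp ((c + d) • s) := by
  rw [add_smul, fexp_add (h.constantCoeff_smul_s c) (h.constantCoeff_smul_s d)
    (((Commute.refl s).smul_left c).smul_right d)]

/-- `1 + η R(e)` is the square of `e^{s/2}`; multiplied by `e^{-s/2}` it gives `e^{s/2}`. -/
theorem fexp_neg_half_mul (h : TwistSetting L R s t e x y a b) :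
    fexp (-(1 / 2 : ℂ) • s) * (1 + eta * R e) = fexp ((1 / 2 : ℂ) • s) := by
  rw [← h.fexp_s, ← one_smul ℂ s, smul_smul, smul_smul, h.fexp_mul_fexp]
  norm_num

theorem fexp_neg_half_mul_fexp_half (h : TwistSetting L R s t e x y a b) :
    fexp (-(1 / 2 : ℂ) • s) * fexp ((1 / 2 : ℂ) • s) = 1 := by
  rw [h.fexp_mul_fexp, neg_add_cancel, zero_smul, fexp_zero]

theorem fexp_half_mul_fexp_neg_half (h : TwistSetting L R s t e x y a b) :
    fexp ((1 / 2 : ℂ) • s) * fexp (-(1 / 2 : ℂ) • s) = 1 := by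
  rw [h.fexp_mul_fexp, add_neg_cancel, zero_smul, fexp_zero]

theorem jordanian_left (h : TwistSetting L R s t e x y a b) {c : ℂ} {z : U}
    (hz : t * z = z * t + c • z) :
    SemiconjBy (fexp (L t * s)) (L z) (L z * fexp (c • s)) := by
  refine fexp_mul_semiconjBy h.constantCoeff_s (h.comm_s _ (h.comm t e).symm).symm
    (h.comm_s _ (h.comm z e).symm) ?_
  rw [← map_mul, hz, map_add, map_mul, map_smul]

theorem jordanian_left_commute (h : TwistSetting L R s t e x y a b) {z : U} (hz : Commute t z) :
    SemiconjBy (fexp (L t * s)) (L z) (L z) :=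
  commute_compSeries (by simp [h.constantCoeff_s]) _
    ((hz.map L).mul_left (h.comm_s _ (h.comm z e).symm))

theorem jordanian_right (h : TwistSetting L R s t e x y a b) {z : U} (hz : Commute e z) :
    SemiconjBy (fexp (L t * s)) (R z) (R z) :=
  commute_compSeries (by simp [h.constantCoeff_s]) _
    ((h.comm t z).mul_left (h.comm_s _ (hz.map R)))

variable [Fintype ι]

theorem extExponent_mul_left_b (h : TwistSetting L R s t e x y a b) (p : ι) :
    extExponent L R s a b * L (b p) = L (b p) * extExponent L R s a b +
      eta * (L e * R (b p)) * fexp (-(1 / 2 : ℂ) • s) := by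
  -- The Heisenberg relation leaves only the summand `q = p`.
  rw [extExponent_mul (c := fun q => if q = p then L e * R (b q) else 0)
    (h.commute_fexp _ (h.comm _ _).symm) fun q => ?_]
  · simp
  · rw [mul_assoc, ← (h.comm (b p) (b q)).eq, ← mul_assoc, ← map_mul, h.rel.a_b, map_add, add_mul,
      map_mul, mul_assoc]
    split_ifs <;> simp

theorem extExponent_mul_right_a (h : TwistSetting L R s t e x y a b) (p : ι) :
    extExponent L R s a b * R (a p) = R (a p) * extExponent L R s a b +
      -(eta * (L (a p) * R e) * fexp (-(1 / 2 : ℂ) • s)) := by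
  rw [extExponent_mul (c := fun q => if p = q then -(L (a q) * R e) else 0)
    (h.commute_fexp _ ((h.rel.e_a p).map R)) fun q => ?_]
  · simp
  · have := h.rel.a_b p q
    rw [mul_assoc, ← map_mul, ← sub_eq_of_eq_add this, map_sub, mul_sub, map_mul, ← mul_assoc,
      (h.comm (a q) (a p)).eq, mul_assoc]
    split_ifs <;> simp [sub_eq_add_neg]

theorem extExponent_mul_right_x (h : TwistSetting L R s t e x y a b) :
    extExponent L R s a b * R x = R x * extExponent L R s a b +
      eta * (∑ q, L (a q) * R (a q)) * fexp (-(1 / 2 : ℂ) • s) := by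
  refine extExponent_mul (h.commute_fexp _ (h.rel.e_x.map R)) fun q => ?_
  rw [mul_assoc, ← map_mul, h.rel.b_x, map_add, mul_add, map_mul, ← mul_assoc, (h.comm (a q) x).eq,
    mul_assoc]

theorem extExponent_mul_left_y (h : TwistSetting L R s t e x y a b) :
    extExponent L R s a b * L y = L y * extExponent L R s a b +
      eta * (∑ q, L (b q) * R (b q)) * fexp (-(1 / 2 : ℂ) • s) := by
  refine extExponent_mul (h.commute_fexp _ (h.comm y e).symm) fun q => ?_
  rw [mul_assoc, ← (h.comm y (b q)).eq, ← mul_assoc, ← map_mul, h.rel.a_y, map_add, add_mul, map_mul,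
    mul_assoc]

theorem commute_extExponent_left_a (h : TwistSetting L R s t e x y a b) (p : ι) :
    Commute (extExponent L R s a b) (L (a p)) :=
  commute_extExponent (h.commute_fexp _ (h.comm _ _).symm) (fun q => (h.rel.a_a q p).map L)
    fun _ => (h.comm _ _).symm

theorem commute_extExponent_right_b (h : TwistSetting L R s t e x y a b) (p : ι) :
    Commute (extExponent L R s a b) (R (b p)) :=
  commute_extExponent (h.commute_fexp _ ((h.rel.e_b p).map R)) (fun _ => h.comm _ _)
    fun q => (h.rel.b_b q p).map R

theorem commute_extExponent_left_e (h : TwistSetting L R s t e x y a b) :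
    Commute (extExponent L R s a b) (L e) :=
  commute_extExponent (h.commute_fexp _ (h.comm _ _).symm) (fun q => ((h.rel.e_a q).map L).symm)
    fun _ => (h.comm _ _).symm

theorem commute_extExponent_right_e (h : TwistSetting L R s t e x y a b) :
    Commute (extExponent L R s a b) (R e) :=
  commute_extExponent (h.commute_fexp _ (Commute.refl _)) (fun _ => h.comm _ _)
    fun q => ((h.rel.e_b q).map R).symm

theorem commute_extExponent_fexp (h : TwistSetting L R s t e x y a b) (c : ℂ) :
    Commute (extExponent L R s a b) (fexp (c • s)) :=
  (h.commute_fexp c h.commute_extExponent_right_e.symm).symm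

theorem commute_extExponent_left_x (h : TwistSetting L R s t e x y a b) :
    Commute (extExponent L R s a b) (L x) :=
  commute_extExponent (h.commute_fexp _ (h.comm _ _).symm) (fun q => ((h.rel.x_a q).map L).symm)
    fun _ => (h.comm _ _).symm

theorem commute_extExponent_right_y (h : TwistSetting L R s t e x y a b) :
    Commute (extExponent L R s a b) (R y) :=
  commute_extExponent (h.commute_fexp _ (h.rel.e_y.map R)) (fun _ => h.comm _ _)
    fun q => ((h.rel.y_b q).map R).symm

/-- The first commutator is built from `L e`, `R (b p)` and `s`, all commuting with the exponent, so
the adjoint series ends at first order. -/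
theorem extension_left_b (h : TwistSetting L R s t e x y a b) (p : ι) :
    SemiconjBy (fexp (extExponent L R s a b)) (L (b p))
      (L (b p) + eta * (L e * R (b p)) * fexp (-(1 / 2 : ℂ) • s)) := by
  have := fexp_semiconjBy constantCoeff_extExponent (h.extExponent_mul_left_b p) (d := 0)
    (by
      rw [add_zero]
      exact (((commute_eta _).symm.mul_right (h.commute_extExponent_left_e.mul_right
        (h.commute_extExponent_right_b p))).mul_right (h.commute_extExponent_fexp _)).eq)
    (Commute.zero_right _)
  simpa using this

theorem extension_right_a (h : TwistSetting L R s t e x y a b) (p : ι) :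
    SemiconjBy (fexp (extExponent L R s a b)) (R (a p))
      (R (a p) - eta * (L (a p) * R e) * fexp (-(1 / 2 : ℂ) • s)) := by
  have := fexp_semiconjBy constantCoeff_extExponent (h.extExponent_mul_right_a p) (d := 0)
    (by
      rw [add_zero]
      exact (((commute_eta _).symm.mul_right ((h.commute_extExponent_left_a p).mul_right
        h.commute_extExponent_right_e)).mul_right (h.commute_extExponent_fexp _)).neg_right.eq)
    (Commute.zero_right _)
  simpa [sub_eq_add_neg] using this

/-- The first commutator contains `R (a q)`, which the exponent moves once more to `L (a q) * R e`;
this second-order term is what `η I^1` will absorb. -/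
theorem extension_right_x (h : TwistSetting L R s t e x y a b) :
    SemiconjBy (fexp (extExponent L R s a b)) (R x)
      (R x + eta * (∑ q, L (a q) * R (a q)) * fexp (-(1 / 2 : ℂ) • s) +
        (1 / 2 : ℂ) • (eta * (∑ q, L (a q) * -(eta * (L (a q) * R e) * fexp (-(1 / 2 : ℂ) • s))) *
          fexp (-(1 / 2 : ℂ) • s))) := by
  refine fexp_semiconjBy constantCoeff_extExponent h.extExponent_mul_right_x ?_ ?_
  · refine extExponent_mul_sum (h.commute_extExponent_fexp _) fun q => ?_
    rw [← mul_assoc, (h.commute_extExponent_left_a q).eq, mul_assoc, h.extExponent_mul_right_a,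
      mul_add, ← mul_assoc (L (a q)) (R (a q))]
  · refine ((commute_eta _).symm.mul_right (Commute.sum_right _ _ _ fun q _ => ?_)).mul_right
      (h.commute_extExponent_fexp _)
    exact (h.commute_extExponent_left_a q).mul_right (((commute_eta _).symm.mul_right
      ((h.commute_extExponent_left_a q).mul_right h.commute_extExponent_right_e)).mul_right
      (h.commute_extExponent_fexp _)).neg_right

/-- As for `R x`, but now it is the factor `L (b q)` of the first commutator that is moved, to `L e
* R (b q)`. -/
theorem extension_left_y (h : TwistSetting L R s t e x y a b) :
    SemiconjBy (fexp (extExponent L R s a b)) (L y)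
      (L y + eta * (∑ q, L (b q) * R (b q)) * fexp (-(1 / 2 : ℂ) • s) +
        (1 / 2 : ℂ) • (eta * (∑ q, eta * (L e * R (b q)) * fexp (-(1 / 2 : ℂ) • s) * R (b q)) *
          fexp (-(1 / 2 : ℂ) • s))) := by
  refine fexp_semiconjBy constantCoeff_extExponent h.extExponent_mul_left_y ?_ ?_
  · refine extExponent_mul_sum (h.commute_extExponent_fexp _) fun q => ?_
    rw [← mul_assoc, h.extExponent_mul_left_b, add_mul, mul_assoc,
      (h.commute_extExponent_right_b q).eq, ← mul_assoc]
  · refine ((commute_eta _).symm.mul_right (Commute.sum_right _ _ _ fun q _ => ?_)).mul_right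
      (h.commute_extExponent_fexp _)
    exact (((commute_eta _).symm.mul_right (h.commute_extExponent_left_e.mul_right
      (h.commute_extExponent_right_b q))).mul_right (h.commute_extExponent_fexp _)).mul_right
      (h.commute_extExponent_right_b q)

end Conjugation

end TwistSetting

end FullChain

/-! ### Twisted coproducts of the carrier generators and cancellation of the non-primitive terms. -/

namespace FullChain

open PowerSeries Finset

section RingIdentities

variable {T : Type} [Ring T]

theorem _root_.SemiconjBy.sum_right {ι : Type} [Fintype ι] {F : T} {z w : ι → T}
    (h : ∀ q, SemiconjBy F (z q) (w q)) : SemiconjBy F (∑ q, z q) (∑ q, w q) := by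
  rw [SemiconjBy, mul_sum, sum_mul]
  exact sum_congr rfl fun q _ => h q

theorem commute_of_mul_eq_one {v w u : T} (hvw : v * w = 1) (hwv : w * v = 1) (h : Commute w u) :
    Commute v u :=
  (Commute.units_inv_left (u := ⟨w, v, hwv, hvw⟩) h : _)

theorem sq_mul_add_of_commute {p q r : T} (hpq : Commute p q) (hpr : Commute p r)
    (hqr : Commute q r) : (p * r + q) ^ 2 = p ^ 2 * (r * r) + 2 • (p * q * r) + q ^ 2 := by
  have h1 : p * r * (p * r) = p * p * (r * r) := by rw [mul_assoc, ← mul_assoc r, ← hpr.eq]; noncomm_ring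
  have h2 : q * (p * r) = p * q * r := by rw [← mul_assoc, hpq.eq]
  have h3 : p * r * q = p * q * r := by rw [mul_assoc, ← hqr.eq, mul_assoc]
  rw [pow_two, mul_add, add_mul, add_mul, h1, h2, h3, pow_two, pow_two, two_smul]
  abel

/-- Conjugation carries inverses to inverses. It gives the twisted coproduct of `e^{-σ}` from that
of `1 + ηe`. -/
theorem mul_eq_of_mul_eq_one {F D d W V : T} (h : F * D = W * F) (hd : D * d = 1) (hV : V * W = 1) :
    F * d = V * F := by
  calc F * d = V * W * (F * d) := by rw [hV, one_mul]
    _ = V * (F * D) * d := by rw [h]; noncomm_ring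
    _ = V * F := by rw [mul_assoc, mul_assoc F, hd, mul_one]

theorem _root_.SemiconjBy.congr_right {F z w w' : T} (h : SemiconjBy F z w) (e : w = w') :
    SemiconjBy F z w' :=
  e ▸ h

variable [Algebra ℂ T]

theorem _root_.SemiconjBy.smul_right' {F z w : T} (h : SemiconjBy F z w) (c : ℂ) :
    SemiconjBy F (c • z) (c • w) := by
  rw [SemiconjBy, mul_smul_comm, h.eq, smul_mul_assoc]

/-- The cancellation in `G_{1-2}` for one index: `p = L a`, `q = R a`, `r = e^{-s/2}`, `z = R e`.
The cross terms `p q r` cancel, and `h`, which says `(1 + η R e) e^{-s} = 1`, reduces the `p²` terms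
to `-½ η p²`. -/
theorem deformed_square_identity {p q r z η : T} (hpq : Commute p q) (hpr : Commute p r)
    (hqr : Commute q r) (hη : ∀ u : T, Commute η u) (h : r * r + η * z * (r * r) = 1) :
    η * (p * q) * r + (1 / 2 : ℂ) • (η * (p * -(η * (p * z) * r)) * r) -
      η * ((1 / 2 : ℂ) • (p * r + q) ^ 2) =
        -(η * ((1 / 2 : ℂ) • p ^ 2)) - η * ((1 / 2 : ℂ) • q ^ 2) := by
  have h1 : η * (p * -(η * (p * z) * r)) * r = η * (p ^ 2 * (r * r)) - η * p ^ 2 := by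
    have : η * z * (r * r) = 1 - r * r := eq_sub_of_add_eq' h
    calc η * (p * -(η * (p * z) * r)) * r = -(η * (p * (η * p) * z * (r * r))) := by noncomm_ring
      _ = -(η * (p ^ 2 * (η * z * (r * r)))) := by rw [(hη p).eq]; noncomm_ring
      _ = _ := by rw [this]; noncomm_ring
  rw [h1, sq_mul_add_of_commute hpq hpr hqr]
  simp only [mul_smul_comm, mul_add, smul_add, smul_sub, mul_assoc, ← Nat.cast_smul_eq_nsmul ℂ,
    smul_smul]
  norm_num
  abel

/-- The cancellation in `G_{2-1}` for one index: `p = L b`, `q = R b`, `ρ = e^{s/2}`, `r =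
e^{-s/2}`, `ε = L e`, `w = 1 + η L e` and `v = w⁻¹`. The factor `v r²` leaves `w q² r²`, whose part
`η ε q² r²` cancels the second-order term of `L y`. -/
theorem deformed_square_identity' {p q r ρ v w ε η : T} (hpq : Commute p q) (hqr : Commute q r)
    (hpρ : Commute p ρ) (hqρ : Commute q ρ)
    (hwp : Commute w p) (hwq : Commute w q) (hwρ : Commute w ρ) (hvρ : Commute v ρ)
    (hvq : Commute v q) (hw : w = 1 + η * ε) (hwv : w * v = 1) (hρ : ρ * r = 1) :
    η * (p * q) * r + (1 / 2 : ℂ) • (η * (η * (ε * q) * r * q) * r) -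
      η * ((1 / 2 : ℂ) • (p * ρ + w * q) ^ 2) * (v * (r * r)) =
        -(η * ((1 / 2 : ℂ) • p ^ 2) * v) - η * ((1 / 2 : ℂ) • q ^ 2) * (r * r) := by
  have h1 : ρ * ρ * (v * (r * r)) = v := by
    rw [← mul_assoc, mul_assoc ρ ρ v, ← hvρ.eq, ← mul_assoc ρ v, ← hvρ.eq,
      show v * ρ * ρ * (r * r) = v * (ρ * (ρ * r) * r) by noncomm_ring, hρ, mul_one, hρ, mul_one]
  have h2 : p * (w * q) * ρ * (v * (r * r)) = p * q * r := by
    calc p * (w * q) * ρ * (v * (r * r)) = p * (w * q) * (ρ * v) * (r * r) := by noncomm_ring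
      _ = p * w * (q * v) * (ρ * r) * r := by rw [← hvρ.eq]; noncomm_ring
      _ = p * (w * v) * q * r := by rw [← hvq.eq, hρ]; noncomm_ring
      _ = _ := by rw [hwv, mul_one]
  have h3 : (w * q) ^ 2 * (v * (r * r)) = q ^ 2 * (r * r) + η * ε * (q ^ 2 * (r * r)) := by
    calc (w * q) ^ 2 * (v * (r * r)) = w * (q * w) * (q * v) * (r * r) := by noncomm_ring
      _ = w * w * (q * q * v) * (r * r) := by rw [← hwq.eq]; noncomm_ring
      _ = w * (w * v) * q ^ 2 * (r * r) := by rw [← (hvq.mul_right hvq).eq]; noncomm_ring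
      _ = _ := by rw [hwv, hw]; noncomm_ring
  have h4 : η * (η * (ε * q) * r * q) * r = η * (η * ε * (q ^ 2 * (r * r))) := by
    rw [mul_assoc _ r q, ← hqr.eq]; noncomm_ring
  rw [h4, sq_mul_add_of_commute (hwp.symm.mul_right hpq) hpρ (hwρ.mul_left hqρ)]
  have h5 : η * ((1 / 2 : ℂ) • (p ^ 2 * (ρ * ρ) + 2 • (p * (w * q) * ρ) + (w * q) ^ 2)) *
      (v * (r * r)) = η * ((1 / 2 : ℂ) • (p ^ 2 * (ρ * ρ * (v * (r * r))) +
        2 • (p * (w * q) * ρ * (v * (r * r))) + (w * q) ^ 2 * (v * (r * r)))) := by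
    rw [mul_assoc η, smul_mul_assoc, add_mul, add_mul, smul_mul_assoc, mul_assoc (p ^ 2)]
  rw [h5, h1, h2, h3]
  simp only [mul_smul_comm, smul_mul_assoc, mul_add, smul_add, mul_assoc,
    ← Nat.cast_smul_eq_nsmul ℂ, smul_smul]
  norm_num
  abel

theorem sum_deformed_square_identity {ι : Type} [Fintype ι] {p q : ι → T} {X Y r z η : T}
    (hpq : ∀ i, Commute (p i) (q i)) (hpr : ∀ i, Commute (p i) r) (hqr : ∀ i, Commute (q i) r)
    (hη : ∀ u : T, Commute η u) (h : r * r + η * z * (r * r) = 1) :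
    X + (Y + η * (∑ i, p i * q i) * r +
        (1 / 2 : ℂ) • (η * (∑ i, p i * -(η * (p i * z) * r)) * r)) -
      η * ((1 / 2 : ℂ) • ∑ i, (p i * r + q i) ^ 2) =
        X - η * ((1 / 2 : ℂ) • ∑ i, p i ^ 2) + (Y - η * ((1 / 2 : ℂ) • ∑ i, q i ^ 2)) := by
  have := sum_congr (rfl : (univ : Finset ι) = univ) fun i _ =>
    deformed_square_identity (hpq i) (hpr i) (hqr i) hη h
  simp only [sum_sub_distrib, sum_add_distrib, sum_neg_distrib, ← mul_sum, ← sum_mul, ← smul_sum]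
    at this
  rw [add_sub_assoc, add_assoc Y, add_sub_assoc, this]
  abel

theorem sum_deformed_square_identity' {ι : Type} [Fintype ι] {p q : ι → T}
    {X Y r ρ v w ε η : T} (hpq : ∀ i, Commute (p i) (q i)) (hqr : ∀ i, Commute (q i) r)
    (hpρ : ∀ i, Commute (p i) ρ) (hqρ : ∀ i, Commute (q i) ρ)
    (hwp : ∀ i, Commute w (p i)) (hwq : ∀ i, Commute w (q i)) (hwρ : Commute w ρ)
    (hvρ : Commute v ρ) (hvq : ∀ i, Commute v (q i)) (hw : w = 1 + η * ε) (hwv : w * v = 1)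
    (hρ : ρ * r = 1) :
    X + η * (∑ i, p i * q i) * r +
        (1 / 2 : ℂ) • (η * (∑ i, η * (ε * q i) * r * q i) * r) + Y -
      η * ((1 / 2 : ℂ) • ∑ i, (p i * ρ + w * q i) ^ 2) * (v * (r * r)) =
        X - η * ((1 / 2 : ℂ) • ∑ i, p i ^ 2) * v +
          (Y - η * ((1 / 2 : ℂ) • ∑ i, q i ^ 2) * (r * r)) := by
  have := sum_congr (rfl : (univ : Finset ι) = univ) fun i _ =>
    deformed_square_identity' (hpq i) (hqr i) (hpρ i) (hqρ i) (hwp i) (hwq i) hwρ hvρ (hvq i) hw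
      hwv hρ
  simp only [sum_sub_distrib, sum_add_distrib, sum_neg_distrib, ← mul_sum, ← sum_mul, ← smul_sum]
    at this
  rw [← sub_eq_zero] at this ⊢
  refine Eq.trans ?_ this
  abel

end RingIdentities

theorem commute_one_add_eta_mul {W : Type} [Ring W] {u z : W⟦X⟧} (h : Commute u z) : Commute (1 + eta * u) z :=
  (Commute.one_left z).add_left ((commute_eta z).mul_left h)

namespace TwistSetting

variable {ι U W : Type} [DecidableEq ι] [Fintype ι] [Ring U] [Algebra ℂ U] [Ring W] [Algebra ℂ W]
  {L R : U →ₐ[ℂ] W⟦X⟧} {s : W⟦X⟧} {t e x y : U} {a b : ι → U}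

variable (L R s t a b) in
/-- The extended Jordanian twist. -/
noncomputable def extendedTwist : W⟦X⟧ := fexp (extExponent L R s a b) * fexp (L t * s)

theorem isUnit_extendedTwist (h : TwistSetting L R s t e x y a b) :
    IsUnit (extendedTwist L R s t a b) :=
  (isUnit_fexp constantCoeff_extExponent).mul (isUnit_fexp (by simp [h.constantCoeff_s]))

/-- The Jordanian factor turns `L a` into `L a e^{s/2}`, the extension subtracts `η L a R e
e^{-s/2}` from `R a`, and `e^{s/2} - η R e e^{-s/2} = e^{-s/2}`. -/
theorem extendedTwist_a (h : TwistSetting L R s t e x y a b) (q : ι) :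
    SemiconjBy (extendedTwist L R s t a b) (L (a q) + R (a q))
      (L (a q) * fexp (-(1 / 2 : ℂ) • s) + R (a q)) := by
  have h1 := ((extension_commute (h.commute_extExponent_left_a q)).mul_right
    (extension_commute (h.commute_extExponent_fexp (1 / 2)))).add_right (h.extension_right_a q)
  refine SemiconjBy.congr_right (h1.mul_left
    ((h.jordanian_left (h.rel.t_a q)).add_right (h.jordanian_right (h.rel.e_a q)))) ?_
  rw [← h.fexp_neg_half_mul, (h.commute_fexp _ (commute_one_add_eta_mul (Commute.refl _)).symm).eq,
    add_mul, ← mul_assoc eta, (commute_eta (L (a q))).eq]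
  noncomm_ring

theorem extendedTwist_b (h : TwistSetting L R s t e x y a b) (q : ι) :
    SemiconjBy (extendedTwist L R s t a b) (L (b q) + R (b q))
      (L (b q) * fexp ((1 / 2 : ℂ) • s) + (1 + eta * L e) * R (b q)) := by
  have h1 := ((h.extension_left_b q).mul_right
    (extension_commute (h.commute_extExponent_fexp (1 / 2)))).add_right
      (extension_commute (h.commute_extExponent_right_b q))
  refine SemiconjBy.congr_right (h1.mul_left
    ((h.jordanian_left (h.rel.t_b q)).add_right (h.jordanian_right (h.rel.e_b q)))) ?_
  rw [add_mul, mul_assoc _ (fexp _) (fexp _), h.fexp_neg_half_mul_fexp_half]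
  noncomm_ring

/-- The element `e` has `t`-weight `1`, so `L e` becomes `L e e^s = L e (1 + η R e)`, while the
extension commutes with `L e` and `R e`: this is group-likeness of `1 + ηe`. -/
theorem extendedTwist_e (h : TwistSetting L R s t e x y a b) :
    SemiconjBy (extendedTwist L R s t a b) (1 + eta * (L e + R e))
      ((1 + eta * L e) * (1 + eta * R e)) := by
  have h1 : SemiconjBy (fexp (L t * s)) (L e) (L e * (1 + eta * R e)) := by
    have := h.jordanian_left (c := 1) (z := e) (by rw [h.rel.t_e, one_smul])
    rwa [one_smul, h.fexp_s] at this
  have h2 (F : W⟦X⟧) : SemiconjBy F eta eta := (commute_eta F).symm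
  have h3 := extension_commute (a := a) (b := b) (s := s) (L := L) h.commute_extExponent_right_e
  have h4 := (SemiconjBy.one_right _).add_right ((h2 _).mul_right
    (((extension_commute h.commute_extExponent_left_e).mul_right
      ((SemiconjBy.one_right _).add_right ((h2 _).mul_right h3))).add_right h3))
  refine SemiconjBy.congr_right (h4.mul_left ((SemiconjBy.one_right _).add_right
    ((h2 _).mul_right (h1.add_right (h.jordanian_right (Commute.refl e)))))) ?_
  noncomm_ring

theorem extendedTwist_x (h : TwistSetting L R s t e x y a b) :
    SemiconjBy (extendedTwist L R s t a b)
      (L x + R x - eta * ((1 / 2 : ℂ) • ∑ q, (L (a q) + R (a q)) ^ 2))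
      (L x - eta * ((1 / 2 : ℂ) • ∑ q, L (a q) ^ 2) +
        (R x - eta * ((1 / 2 : ℂ) • ∑ q, R (a q) ^ 2))) := by
  have h1 := ((extension_commute h.commute_extExponent_left_x).mul_left
    (h.jordanian_left_commute h.rel.t_x)).add_right
      (h.extension_right_x.mul_left (h.jordanian_right h.rel.e_x))
  have hη : SemiconjBy (extendedTwist L R s t a b) eta eta := (commute_eta _).symm
  have hsum := (SemiconjBy.sum_right fun q => (h.extendedTwist_a q).pow_right 2).smul_right' (1 / 2)
  have h2 := SemiconjBy.sub_right h1 (hη.mul_right hsum)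
  have h3 : fexp (-(1 / 2 : ℂ) • s) * fexp (-(1 / 2 : ℂ) • s) +
      eta * R e * (fexp (-(1 / 2 : ℂ) • s) * fexp (-(1 / 2 : ℂ) • s)) = 1 := by
    have := h.commute_fexp (-(1 / 2)) (commute_one_add_eta_mul (Commute.refl (R e))).symm
    rw [← one_add_mul, ← mul_assoc, ← this.eq, h.fexp_neg_half_mul, h.fexp_half_mul_fexp_neg_half]
  exact SemiconjBy.congr_right h2 (sum_deformed_square_identity (fun q => h.comm (a q) (a q))
    (fun q => (h.commute_fexp (-(1 / 2)) (h.comm (a q) e).symm).symm)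
    (fun q => (h.commute_fexp (-(1 / 2)) ((h.rel.e_a q).map R)).symm) commute_eta h3)

/-- Here `v` and `d` stand for `e^{-σ} ⊗ 1` and `Δ(e^{-σ})`. Only their being inverses matters, so
the coproduct of the logarithm is never needed. -/
theorem extendedTwist_y (h : TwistSetting L R s t e x y a b) {v d : W⟦X⟧}
    (hv : (1 + eta * L e) * v = 1) (hv' : v * (1 + eta * L e) = 1)
    (hd : (1 + eta * (L e + R e)) * d = 1) :
    SemiconjBy (extendedTwist L R s t a b)
      (L y + R y - eta * ((1 / 2 : ℂ) • ∑ q, (L (b q) + R (b q)) ^ 2) * d)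
      (L y - eta * ((1 / 2 : ℂ) • ∑ q, L (b q) ^ 2) * v +
        (R y - eta * ((1 / 2 : ℂ) • ∑ q, R (b q) ^ 2) * fexp (-s))) := by
  have h0 : fexp (-s) = fexp (-(1 / 2 : ℂ) • s) * fexp (-(1 / 2 : ℂ) • s) := by
    rw [h.fexp_mul_fexp, ← neg_one_smul ℂ s]
    norm_num
  have hd' : SemiconjBy (extendedTwist L R s t a b) d
      (v * (fexp (-(1 / 2 : ℂ) • s) * fexp (-(1 / 2 : ℂ) • s))) := by
    refine mul_eq_of_mul_eq_one h.extendedTwist_e hd ?_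
    have h5 := h.commute_fexp (-(1 / 2)) (commute_one_add_eta_mul (h.comm e e)).symm
    rw [mul_assoc, ← mul_assoc _ (1 + eta * L e), (h5.mul_left h5).eq, mul_assoc (1 + eta * L e),
      mul_assoc _ _ (1 + eta * R e), h.fexp_neg_half_mul, h.fexp_neg_half_mul_fexp_half, mul_one,
      hv']
  have h1 := (h.extension_left_y.mul_left (h.jordanian_left_commute h.rel.t_y)).add_right
    ((extension_commute h.commute_extExponent_right_y).mul_left (h.jordanian_right h.rel.e_y))
  have hη : SemiconjBy (extendedTwist L R s t a b) eta eta := (commute_eta _).symm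
  have hsum := (SemiconjBy.sum_right fun q => (h.extendedTwist_b q).pow_right 2).smul_right' (1 / 2)
  have h2 := SemiconjBy.sub_right h1 ((hη.mul_right hsum).mul_right hd')
  have hvz {z : W⟦X⟧} (hz : Commute (L e) z) : Commute v z :=
    commute_of_mul_eq_one hv' hv (commute_one_add_eta_mul hz)
  have hLe (c : ℂ) : Commute (L e) (fexp (c • s)) := (h.commute_fexp c (h.comm e e).symm).symm
  rw [h0]
  exact SemiconjBy.congr_right h2 (sum_deformed_square_identity' (fun q => h.comm (b q) (b q))
    (fun q => (h.commute_fexp (-(1 / 2)) ((h.rel.e_b q).map R)).symm)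
    (fun q => (h.commute_fexp (1 / 2) (h.comm (b q) e).symm).symm)
    (fun q => (h.commute_fexp (1 / 2) ((h.rel.e_b q).map R)).symm)
    (fun q => commute_one_add_eta_mul ((h.rel.e_b q).map L))
    (fun q => commute_one_add_eta_mul (h.comm e (b q))) (commute_one_add_eta_mul (hLe _))
    (hvz (hLe _)) (fun q => hvz (h.comm e (b q))) rfl hv h.fexp_half_mul_fexp_neg_half)

end TwistSetting

end FullChain

/-! ### Infinitesimal rotations and scalar products of the isotropic vectors. -/

namespace FullChain

open Finset Matrix

section Wedge

variable {M : ℕ}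

theorem so_val_add (x y : so (Fin M) ℂ) : (x + y).val = x.val + y.val := rfl

theorem so_val_sub (x y : so (Fin M) ℂ) : (x - y).val = x.val - y.val := rfl

theorem so_val_smul (c : ℂ) (x : so (Fin M) ℂ) : (c • x).val = c • x.val := rfl

theorem wedge_val (a b : Fin M → ℂ) :
    (wedge a b).val = Matrix.vecMulVec a b - Matrix.vecMulVec b a := rfl

theorem wedge_self (a : Fin M → ℂ) : wedge a a = 0 := Subtype.ext (sub_self _)

theorem wedge_swap (a b : Fin M → ℂ) : wedge a b = -wedge b a :=
  Subtype.ext (neg_sub _ _).symm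

/-- `b ↦ a ∧ b` as a linear map. -/
def wedgeLinear (a : Fin M → ℂ) : (Fin M → ℂ) →ₗ[ℂ] so (Fin M) ℂ where
  toFun b := wedge a b
  map_add' b c := Subtype.ext (by
    simp only [wedge_val, so_val_add, vecMulVec_add, add_vecMulVec]; abel)
  map_smul' r b := Subtype.ext (by
    simp only [wedge_val, so_val_smul, vecMulVec_smul, smul_vecMulVec, smul_sub,
      RingHom.id_apply])

theorem wedgeLinear_apply (a b : Fin M → ℂ) : wedgeLinear a b = wedge a b := rfl

theorem bracket_wedge (a b c d : Fin M → ℂ) :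
    ⁅wedge a b, wedge c d⁆ = (b ⬝ᵥ c) • wedge a d - (a ⬝ᵥ c) • wedge b d + (b ⬝ᵥ d) • wedge c a -
      (a ⬝ᵥ d) • wedge c b := by
  refine Subtype.ext ?_
  ext i j
  simp only [LieSubalgebra.coe_bracket, LieRing.of_associative_ring_bracket, wedge_val,
    so_val_add, so_val_sub, so_val_smul, sub_mul, mul_sub,
    vecMulVec_mul_vecMulVec, Matrix.sub_apply, Matrix.add_apply, Matrix.smul_apply, vecMulVec_apply,
    smul_eq_mul, dotProduct_comm d, dotProduct_comm c]
  simp only [Pi.smul_apply, smul_eq_mul]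
  ring

/-- Skewness turns the right action on row vectors into minus the left action on columns, so the
bracket acts as a derivation on wedges. -/
theorem bracket_soIncl_wedge {s : ℕ} (x : so (Fin (M - s)) ℂ) (a b : Fin M → ℂ) :
    ⁅soIncl M s x, wedge a b⁆ =
      wedge ((soIncl M s x).val *ᵥ a) b + wedge a ((soIncl M s x).val *ᵥ b) := by
  have h := (mem_so (Fin M) ℂ (soIncl M s x).val).1 (soIncl M s x).2
  have h2 (u : Fin M → ℂ) : u ᵥ* (soIncl M s x).val = -((soIncl M s x).val *ᵥ u) := by
    rw [← mulVec_transpose, h, neg_mulVec]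
  refine Subtype.ext ?_
  simp only [LieSubalgebra.coe_bracket, LieRing.of_associative_ring_bracket, wedge_val,
    so_val_add, mul_sub, sub_mul, mul_vecMulVec, vecMulVec_mul, h2, vecMulVec_neg]
  abel

/-- The standard basis vector at position `i` (counted from `0`). -/
def stdVec (M i : ℕ) : Fin M → ℂ := fun p => if p.val = i then 1 else 0

theorem stdVec_dotProduct {i : ℕ} (hi : i < M) (u : Fin M → ℂ) : stdVec M i ⬝ᵥ u = u ⟨i, hi⟩ := by
  rw [dotProduct, sum_eq_single ⟨i, hi⟩]
  · simp [stdVec]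
  · intro p _ hp
    have : p.val ≠ i := fun h => hp (Fin.ext h)
    simp [stdVec, this]
  · simp

theorem posVec_eq (M j : ℕ) :
    posVec M (j + 1) = stdVec M (2 * j) + Complex.I • stdVec M (2 * j + 1) := by
  funext p
  simp only [posVec, stdVec, Pi.add_apply, Pi.smul_apply, smul_eq_mul]
  split_ifs <;> first | omega | simp

theorem negVec_eq (M j : ℕ) :
    negVec M (j + 1) =
      (1 / 2 : ℂ) • stdVec M (2 * j) - (Complex.I / 2) • stdVec M (2 * j + 1) := by
  funext p
  simp only [negVec, stdVec, Pi.sub_apply, Pi.smul_apply, smul_eq_mul]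
  split_ifs <;> first | omega | simp

theorem posVec_dotProduct {j : ℕ} (hj : 2 * j + 1 < M) (u : Fin M → ℂ) :
    posVec M (j + 1) ⬝ᵥ u = u ⟨2 * j, by omega⟩ + Complex.I * u ⟨2 * j + 1, hj⟩ := by
  rw [posVec_eq, add_dotProduct, smul_dotProduct, stdVec_dotProduct, stdVec_dotProduct hj,
    smul_eq_mul]

theorem negVec_dotProduct {j : ℕ} (hj : 2 * j + 1 < M) (u : Fin M → ℂ) :
    negVec M (j + 1) ⬝ᵥ u =
      (1 / 2) * u ⟨2 * j, by omega⟩ - (Complex.I / 2) * u ⟨2 * j + 1, hj⟩ := by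
  rw [negVec_eq, sub_dotProduct, smul_dotProduct, smul_dotProduct, stdVec_dotProduct,
    stdVec_dotProduct hj, smul_eq_mul, smul_eq_mul]

theorem posVec_dotProduct_posVec {i j : ℕ} (hi : 2 * i + 1 < M) :
    posVec M (i + 1) ⬝ᵥ posVec M (j + 1) = 0 := by
  rw [posVec_dotProduct hi, posVec, posVec]
  dsimp only
  split_ifs <;> first | omega | simp

theorem negVec_dotProduct_negVec {i j : ℕ} (hi : 2 * i + 1 < M) :
    negVec M (i + 1) ⬝ᵥ negVec M (j + 1) = 0 := by
  rw [negVec_dotProduct hi, negVec, negVec]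
  dsimp only
  split_ifs <;> first | omega | ring_nf
  simp only [Complex.I_sq]; norm_num

theorem posVec_dotProduct_negVec {i j : ℕ} (hi : 2 * i + 1 < M) :
    posVec M (i + 1) ⬝ᵥ negVec M (j + 1) = if i = j then 1 else 0 := by
  rw [posVec_dotProduct hi, negVec, negVec]
  dsimp only
  split_ifs <;> first | omega | ring_nf
  simp only [Complex.I_sq]; norm_num

theorem negVec_dotProduct_posVec {i j : ℕ} (hj : 2 * j + 1 < M) :
    negVec M (i + 1) ⬝ᵥ posVec M (j + 1) = if j = i then 1 else 0 := by
  rw [dotProduct_comm, posVec_dotProduct_negVec hj]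

theorem posVec_dotProduct_stdVec {i j : ℕ} (hi : 2 * i + 1 < j) :
    posVec M (i + 1) ⬝ᵥ stdVec M j = 0 :=
  sum_eq_zero fun p _ => by
    simp only [posVec, stdVec]
    split_ifs <;> first | omega | simp

theorem negVec_dotProduct_stdVec {i j : ℕ} (hi : 2 * i + 1 < j) :
    negVec M (i + 1) ⬝ᵥ stdVec M j = 0 :=
  sum_eq_zero fun p _ => by
    simp only [negVec, stdVec]
    split_ifs <;> first | omega | simp

end Wedge

/-! ### The invariant tensor in isotropic and orthonormal bases. -/

section CasimirSum

variable {V : Type*} [AddCommGroup V]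

theorem sum_range_two_mul (f : ℕ → V) (n : ℕ) :
    ∑ i ∈ range n, (f (2 * i) + f (2 * i + 1)) = ∑ i ∈ range (2 * n), f i := by
  induction n with
  | zero => simp
  | succ n ih =>
    rw [sum_range_succ, ih, show 2 * (n + 1) = 2 * n + 1 + 1 by ring, sum_range_succ,
      sum_range_succ, add_assoc]

variable [Module ℂ V]

/-- The imaginary cross terms of the two orderings are opposite, and the factor `½` in `v_{-j}` is
compensated by there being two of them. -/
theorem apply_posVec_negVec {M : ℕ} (β : (Fin M → ℂ) →ₗ[ℂ] (Fin M → ℂ) →ₗ[ℂ] V) (j : ℕ) :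
    β (posVec M (j + 1)) (negVec M (j + 1)) + β (negVec M (j + 1)) (posVec M (j + 1)) =
      β (stdVec M (2 * j)) (stdVec M (2 * j)) +
        β (stdVec M (2 * j + 1)) (stdVec M (2 * j + 1)) := by
  simp only [posVec_eq, negVec_eq, map_add, map_sub, map_smul, LinearMap.add_apply,
    LinearMap.sub_apply, LinearMap.smul_apply, smul_sub, smul_add, smul_smul]
  match_scalars <;> ring_nf
  all_goals simp

/-- The invariant tensor of `so(M-4(k+1))` in an orthonormal and in an isotropic basis. -/
theorem sum_isotropic_eq_sum_orthonormal {M k : ℕ} (hM : 4 * (k + 1) ≤ M)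
    (β : (Fin M → ℂ) →ₗ[ℂ] (Fin M → ℂ) →ₗ[ℂ] V) :
    (if Odd M then β (zeroVec M) (zeroVec M) else 0) +
        ∑ l ∈ Icc 3 (rk M k),
          (β (posVec M (2 * k + l)) (negVec M (2 * k + l)) +
            β (negVec M (2 * k + l)) (posVec M (2 * k + l))) =
      ∑ q : Fin (M - 4 * (k + 1)),
        β (stdVec M (4 * (k + 1) + q)) (stdVec M (4 * (k + 1) + q)) := by
  set f : ℕ → V := fun i => β (stdVec M (4 * (k + 1) + i)) (stdVec M (4 * (k + 1) + i)) with hf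
  have h1 : ∑ l ∈ Icc 3 (rk M k), (β (posVec M (2 * k + l)) (negVec M (2 * k + l)) +
      β (negVec M (2 * k + l)) (posVec M (2 * k + l))) =
      ∑ i ∈ range (2 * (rk M k - 2)), f i := by
    rw [show Icc 3 (rk M k) = Ico 3 (rk M k + 1) from rfl, sum_Ico_eq_sum_range,
      show rk M k + 1 - 3 = rk M k - 2 by omega, ← sum_range_two_mul]
    refine sum_congr rfl fun i _ => ?_
    -- The weight index `l = 3 + i` occupies the coordinates `4(k+1) + 2i` and the next one, counted
    -- from `0`; so `l = 3` starts exactly at the block of `g_{k+1}`.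
    rw [show 2 * k + (3 + i) = (2 * k + 2 + i) + 1 by ring, apply_posVec_negVec, hf]
    simp only [show 2 * (2 * k + 2 + i) = 4 * (k + 1) + 2 * i by ring,
      show 4 * (k + 1) + 2 * i + 1 = 4 * (k + 1) + (2 * i + 1) from rfl]
  rw [h1, Fin.sum_univ_eq_sum_range f]
  split_ifs with h
  -- For odd `M` one coordinate of the block remains unpaired, the last one, and it is `v_0`.
  · have h2 : M - 4 * (k + 1) = 2 * (rk M k - 2) + 1 := by
      obtain ⟨c, rfl⟩ := h; rw [rk]; omega
    have h3 : zeroVec M = stdVec M (4 * (k + 1) + 2 * (rk M k - 2)) := by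
      funext p
      have : p.val + 1 = M ↔ p.val = 4 * (k + 1) + 2 * (rk M k - 2) := by omega
      simp only [zeroVec, stdVec, this]
    rw [h2, sum_range_succ, h3, add_comm]
  · have h2 : M - 4 * (k + 1) = 2 * (rk M k - 2) := by
      obtain ⟨c, rfl⟩ := Nat.not_odd_iff_even.1 h; rw [rk]; omega
    rw [h2, zero_add]

end CasimirSum

end FullChain

/-! ### Realization of the carrier relations in `so(M)`. -/

namespace FullChain

open Finset Matrix

section CarrierInOrthogonal

variable {M k : ℕ}

/-- The root vector `v_a ∧ ε_q`, with `ε_q` the `q`-th standard basis vector of the space on which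
`g_{k+1}` acts. -/
def rootOrtho (M k a : ℕ) (q : Fin (M - 4 * (k + 1))) : so (Fin M) ℂ :=
  wedge (posVec M (2 * k + a)) (stdVec M (4 * (k + 1) + q))

/-- The scalar products of the vectors `v_{±1}`, `v_{±2}` of `g_k`. -/
theorem dotProduct_isotropic (hM : 4 * (k + 1) ≤ M) :
    (posVec M (2 * k + 1) ⬝ᵥ posVec M (2 * k + 1) = 0 ∧
      posVec M (2 * k + 1) ⬝ᵥ posVec M (2 * k + 2) = 0 ∧
      posVec M (2 * k + 2) ⬝ᵥ posVec M (2 * k + 1) = 0 ∧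
      posVec M (2 * k + 2) ⬝ᵥ posVec M (2 * k + 2) = 0) ∧
    (negVec M (2 * k + 1) ⬝ᵥ negVec M (2 * k + 1) = 0 ∧
      negVec M (2 * k + 1) ⬝ᵥ negVec M (2 * k + 2) = 0 ∧
      negVec M (2 * k + 2) ⬝ᵥ negVec M (2 * k + 1) = 0 ∧
      negVec M (2 * k + 2) ⬝ᵥ negVec M (2 * k + 2) = 0) ∧
    (posVec M (2 * k + 1) ⬝ᵥ negVec M (2 * k + 1) = 1 ∧
      posVec M (2 * k + 1) ⬝ᵥ negVec M (2 * k + 2) = 0 ∧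
      posVec M (2 * k + 2) ⬝ᵥ negVec M (2 * k + 1) = 0 ∧
      posVec M (2 * k + 2) ⬝ᵥ negVec M (2 * k + 2) = 1) ∧
    negVec M (2 * k + 1) ⬝ᵥ posVec M (2 * k + 1) = 1 ∧
      negVec M (2 * k + 1) ⬝ᵥ posVec M (2 * k + 2) = 0 ∧
      negVec M (2 * k + 2) ⬝ᵥ posVec M (2 * k + 1) = 0 ∧
      negVec M (2 * k + 2) ⬝ᵥ posVec M (2 * k + 2) = 1 := by
  have h1 : 2 * (2 * k) + 1 < M := by omega
  have h2 : 2 * (2 * k + 1) + 1 < M := by omega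
  refine ⟨⟨posVec_dotProduct_posVec h1, posVec_dotProduct_posVec h1, posVec_dotProduct_posVec h2,
    posVec_dotProduct_posVec h2⟩, ⟨negVec_dotProduct_negVec h1, negVec_dotProduct_negVec h1,
    negVec_dotProduct_negVec h2, negVec_dotProduct_negVec h2⟩,
    ⟨(posVec_dotProduct_negVec h1).trans ?_, (posVec_dotProduct_negVec h1).trans ?_,
    (posVec_dotProduct_negVec h2).trans ?_, (posVec_dotProduct_negVec h2).trans ?_⟩,
    (negVec_dotProduct_posVec h1).trans ?_, (negVec_dotProduct_posVec h2).trans ?_,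
    (negVec_dotProduct_posVec h1).trans ?_, (negVec_dotProduct_posVec h2).trans ?_⟩
  all_goals simp

theorem dotProduct_isotropic_stdVec (q : ℕ) :
    (posVec M (2 * k + 1) ⬝ᵥ stdVec M (4 * (k + 1) + q) = 0 ∧
      posVec M (2 * k + 2) ⬝ᵥ stdVec M (4 * (k + 1) + q) = 0 ∧
      negVec M (2 * k + 1) ⬝ᵥ stdVec M (4 * (k + 1) + q) = 0 ∧
      negVec M (2 * k + 2) ⬝ᵥ stdVec M (4 * (k + 1) + q) = 0) ∧
    stdVec M (4 * (k + 1) + q) ⬝ᵥ posVec M (2 * k + 1) = 0 ∧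
      stdVec M (4 * (k + 1) + q) ⬝ᵥ posVec M (2 * k + 2) = 0 ∧
      stdVec M (4 * (k + 1) + q) ⬝ᵥ negVec M (2 * k + 1) = 0 ∧
      stdVec M (4 * (k + 1) + q) ⬝ᵥ negVec M (2 * k + 2) = 0 := by
  have h1 : 2 * (2 * k) + 1 < 4 * (k + 1) + q := by omega
  have h2 : 2 * (2 * k + 1) + 1 < 4 * (k + 1) + q := by omega
  simp only [dotProduct_comm (stdVec M (4 * (k + 1) + q))]
  have e1 : posVec M (2 * k + 1) ⬝ᵥ stdVec M (4 * (k + 1) + q) = 0 := posVec_dotProduct_stdVec h1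
  have e2 : posVec M (2 * k + 2) ⬝ᵥ stdVec M (4 * (k + 1) + q) = 0 := posVec_dotProduct_stdVec h2
  have e3 : negVec M (2 * k + 1) ⬝ᵥ stdVec M (4 * (k + 1) + q) = 0 := negVec_dotProduct_stdVec h1
  have e4 : negVec M (2 * k + 2) ⬝ᵥ stdVec M (4 * (k + 1) + q) = 0 := negVec_dotProduct_stdVec h2
  simp [e1, e2, e3, e4]

theorem stdVec_dotProduct_stdVec {q r : Fin (M - 4 * (k + 1))} :
    stdVec M (4 * (k + 1) + q) ⬝ᵥ stdVec M (4 * (k + 1) + r) = if q = r then 1 else 0 := by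
  rw [stdVec_dotProduct (by omega), stdVec]
  simp [Fin.ext_iff]

variable (q r : Fin (M - 4 * (k + 1)))

/-- The brackets of `v_1 ∧ ε_q` and `v_2 ∧ ε_q` with each other. -/
theorem bracket_rootOrtho (hM : 4 * (k + 1) ≤ M) :
    ⁅rootOrtho M k 1 q, rootOrtho M k 1 r⁆ = 0 ∧ ⁅rootOrtho M k 2 q, rootOrtho M k 2 r⁆ = 0 ∧
      ⁅rootOrtho M k 1 q, rootOrtho M k 2 r⁆ = if q = r then rootInit M k else 0 := by
  simp only [rootOrtho, rootInit, bracket_wedge, dotProduct_isotropic hM,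
    dotProduct_isotropic_stdVec, stdVec_dotProduct_stdVec, wedge_self]
  split_ifs <;> simp

theorem bracket_rootInit (hM : 4 * (k + 1) ≤ M) :
    ⁅rootInit M k, rootOrtho M k 1 q⁆ = 0 ∧ ⁅rootInit M k, rootOrtho M k 2 q⁆ = 0 := by
  simp [rootOrtho, rootInit, bracket_wedge, dotProduct_isotropic hM, dotProduct_isotropic_stdVec,
    wedge_self]

theorem bracket_rootInit_root (hM : 4 * (k + 1) ≤ M) :
    ⁅rootInit M k, root12 M k⁆ = 0 ∧ ⁅rootInit M k, root21 M k⁆ = 0 := by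
  simp [rootInit, root12, root21, bracket_wedge, dotProduct_isotropic hM, wedge_self]

theorem bracket_root12 (hM : 4 * (k + 1) ≤ M) :
    ⁅root12 M k, rootOrtho M k 1 q⁆ = 0 ∧ ⁅rootOrtho M k 2 q, root12 M k⁆ = rootOrtho M k 1 q := by
  refine ⟨?_, ?_⟩
  · simp [rootOrtho, root12, bracket_wedge, dotProduct_isotropic hM, dotProduct_isotropic_stdVec,
      wedge_self]
  · simp [rootOrtho, root12, bracket_wedge, dotProduct_isotropic hM, dotProduct_isotropic_stdVec,
      wedge_swap (stdVec M _)]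

theorem bracket_root12_root21 (hM : 4 * (k + 1) ≤ M) :
    ⁅root12 M k, root21 M k⁆ = (2 : ℂ) • cartanMinus M k := by
  simp only [root12, root21, cartanMinus, cartan, bracket_wedge, dotProduct_isotropic hM]
  rw [wedge_swap (negVec M (2 * k + 2)) (posVec M (2 * k + 2)),
    wedge_swap (negVec M (2 * k + 1)) (posVec M (2 * k + 1))]
  module

theorem bracket_root21 (hM : 4 * (k + 1) ≤ M) :
    ⁅root21 M k, rootOrtho M k 2 q⁆ = 0 ∧ ⁅rootOrtho M k 1 q, root21 M k⁆ = rootOrtho M k 2 q := by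
  refine ⟨?_, ?_⟩
  · simp [rootOrtho, root21, bracket_wedge, dotProduct_isotropic hM, dotProduct_isotropic_stdVec,
      wedge_self]
  · simp [rootOrtho, root21, bracket_wedge, dotProduct_isotropic hM, dotProduct_isotropic_stdVec,
      wedge_swap (stdVec M _)]

theorem bracket_cartan_one (hM : 4 * (k + 1) ≤ M) :
    ⁅cartan M k 1, rootOrtho M k 1 q⁆ = rootOrtho M k 1 q ∧
      ⁅cartan M k 1, rootOrtho M k 2 q⁆ = 0 := by
  simp [rootOrtho, cartan, bracket_wedge, dotProduct_isotropic hM, dotProduct_isotropic_stdVec]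

theorem bracket_cartan_one_root (hM : 4 * (k + 1) ≤ M) :
    ⁅cartan M k 1, rootInit M k⁆ = rootInit M k ∧ ⁅cartan M k 1, root12 M k⁆ = root12 M k ∧
      ⁅cartan M k 1, root21 M k⁆ = -root21 M k ∧ ⁅cartan M k 1, cartan M k 2⁆ = 0 := by
  simp [rootInit, root12, root21, cartan, bracket_wedge, dotProduct_isotropic hM]

theorem bracket_cartan_two (hM : 4 * (k + 1) ≤ M) :
    ⁅cartan M k 2, rootOrtho M k 1 q⁆ = 0 ∧
      ⁅cartan M k 2, rootOrtho M k 2 q⁆ = rootOrtho M k 2 q := by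
  simp [rootOrtho, cartan, bracket_wedge, dotProduct_isotropic hM, dotProduct_isotropic_stdVec]

theorem bracket_cartan_two_root (hM : 4 * (k + 1) ≤ M) :
    ⁅cartan M k 2, rootInit M k⁆ = rootInit M k ∧ ⁅cartan M k 2, root12 M k⁆ = -root12 M k ∧
      ⁅cartan M k 2, root21 M k⁆ = root21 M k := by
  simp [rootInit, root12, root21, cartan, bracket_wedge, dotProduct_isotropic hM]

theorem inU_mul {u v w : so (Fin M) ℂ} (h : ⁅u, v⁆ = w) :
    inU M u * inU M v = inU M v * inU M u + inU M w := by
  rw [← h, LieHom.map_lie, LieRing.of_associative_ring_bracket]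
  abel

theorem inU_commute {u v : so (Fin M) ℂ} (h : ⁅u, v⁆ = 0) : Commute (inU M u) (inU M v) := by
  rw [Commute, SemiconjBy, inU_mul h, map_zero, add_zero]

theorem carrierRelations (hM : 4 * (k + 1) ≤ M) :
    CarrierRelations (inU M (cartanPlus M k)) (inU M (rootInit M k)) (inU M (root12 M k))
      (inU M (root21 M k)) (fun q => inU M (rootOrtho M k 1 q))
      (fun q => inU M (rootOrtho M k 2 q)) where
  a_b q r := by
    rw [inU_mul (bracket_rootOrtho q r hM).2.2]
    split_ifs <;> simp
  a_a q r := inU_commute (bracket_rootOrtho q r hM).1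
  b_b q r := inU_commute (bracket_rootOrtho q r hM).2.1
  e_a q := inU_commute (bracket_rootInit q hM).1
  e_b q := inU_commute (bracket_rootInit q hM).2
  e_x := inU_commute (bracket_rootInit_root hM).1
  e_y := inU_commute (bracket_rootInit_root hM).2
  x_a q := inU_commute (bracket_root12 q hM).1
  y_b q := inU_commute (bracket_root21 q hM).1
  b_x q := inU_mul (bracket_root12 q hM).2
  a_y q := inU_mul (bracket_root21 q hM).2
  t_e := inU_mul (by
    rw [cartanPlus, smul_lie, add_lie, (bracket_cartan_one_root hM).1, (bracket_cartan_two_root hM).1]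
    module)
  t_a q := by
    rw [← map_smul]
    exact inU_mul (by
      rw [cartanPlus, smul_lie, add_lie, (bracket_cartan_one q hM).1, (bracket_cartan_two q hM).1,
        add_zero])
  t_b q := by
    rw [← map_smul]
    exact inU_mul (by
      rw [cartanPlus, smul_lie, add_lie, (bracket_cartan_one q hM).2, (bracket_cartan_two q hM).2,
        zero_add])
  t_x := inU_commute (by
    rw [cartanPlus, smul_lie, add_lie, (bracket_cartan_one_root hM).2.1,
      (bracket_cartan_two_root hM).2.1, add_neg_cancel, smul_zero])
  t_y := inU_commute (by
    rw [cartanPlus, smul_lie, add_lie, (bracket_cartan_one_root hM).2.2.1,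
      (bracket_cartan_two_root hM).2.2, neg_add_cancel, smul_zero])

theorem bracket_cartanMinus (hM : 4 * (k + 1) ≤ M) :
    ⁅cartanMinus M k, rootOrtho M k 1 q⁆ = (1 / 2 : ℂ) • rootOrtho M k 1 q ∧
      ⁅cartanMinus M k, rootOrtho M k 2 q⁆ = -((1 / 2 : ℂ) • rootOrtho M k 2 q) := by
  rw [cartanMinus, smul_lie, sub_lie, (bracket_cartan_one q hM).1, (bracket_cartan_two q hM).1,
    smul_lie, sub_lie, (bracket_cartan_one q hM).2, (bracket_cartan_two q hM).2]
  simp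

theorem bracket_cartanMinus_root (hM : 4 * (k + 1) ≤ M) :
    ⁅cartanMinus M k, rootInit M k⁆ = 0 ∧ ⁅cartanMinus M k, root12 M k⁆ = root12 M k ∧
      ⁅cartanMinus M k, root21 M k⁆ = -root21 M k ∧ ⁅cartanPlus M k, cartanMinus M k⁆ = 0 := by
  obtain ⟨h1, h2, h3, h4⟩ := bracket_cartan_one_root hM
  obtain ⟨k1, k2, k3⟩ := bracket_cartan_two_root hM
  have h5 : ⁅cartan M k 2, cartan M k 1⁆ = 0 := by rw [← lie_skew, h4, neg_zero]
  refine ⟨?_, ?_, ?_, ?_⟩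
  · rw [cartanMinus, smul_lie, sub_lie, h1, k1, sub_self, smul_zero]
  · rw [cartanMinus, smul_lie, sub_lie, h2, k2]; module
  · rw [cartanMinus, smul_lie, sub_lie, h3, k3]; module
  · simp [cartanMinus, cartanPlus, h4, h5]

/-- `inU` of `v_a ∧ u`, as a linear function of `u`. -/
noncomputable def rootLinear (M k a : ℕ) : (Fin M → ℂ) →ₗ[ℂ] U M :=
  (inU M).toLinearMap ∘ₗ wedgeLinear (posVec M (2 * k + a))

theorem rootLinear_apply (a : ℕ) (u : Fin M → ℂ) :
    rootLinear M k a u = inU M (wedge (posVec M (2 * k + a)) u) := rfl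

theorem invTensor_eq (hM : 4 * (k + 1) ≤ M) :
    invTensor M k 1 2 = ∑ q, inU M (rootOrtho M k 1 q) ⊗ₜ[ℂ] inU M (rootOrtho M k 2 q) :=
  sum_isotropic_eq_sum_orthonormal hM
    ((TensorProduct.mk ℂ (U M) (U M)).compl₁₂ (rootLinear M k 1) (rootLinear M k 2))

/-- Apply the change of basis to the bilinear map `(u, w) ↦ (v_a ∧ u)(v_a ∧ w)`. It gives `2 I^a`,
because `E_{a+l}` and `E_{a-l}` commute. -/
theorem inv_eq (hM : 4 * (k + 1) ≤ M) {a : ℕ} (ha : a = 1 ∨ a = 2) :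
    inv M k a = (1 / 2 : ℂ) • ∑ q, inU M (rootOrtho M k a q) ^ 2 := by
  have h := sum_isotropic_eq_sum_orthonormal hM
    ((LinearMap.mul ℂ (U M)).compl₁₂ (rootLinear M k a) (rootLinear M k a))
  simp only [LinearMap.compl₁₂_apply, LinearMap.mul_apply', rootLinear_apply] at h
  have h1 : inv M k a = (1 / 2 : ℂ) • ((2 : ℂ) • inv M k a) := by rw [smul_smul]; norm_num
  rw [h1]
  congr 1
  simp only [pow_two, rootOrtho]
  rw [← h, inv, smul_add, smul_sum]
  congr 1
  · split_ifs
    · rw [smul_smul, pow_two, rootShort]; norm_num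
    · rw [smul_zero]
  · refine sum_congr rfl fun l hl => ?_
    have hl3 := (mem_Icc.1 hl).1
    -- The vector `v_a` is isotropic and orthogonal to `v_{±l}`, and the remaining product `v_l ·
    -- v_{-l}` multiplies `v_a ∧ v_a = 0`.
    have hc : Commute (inU M (rootPlus M k a l)) (inU M (rootMinus M k a l)) := by
      obtain ⟨c, hc, rfl⟩ : ∃ c, c ≤ 1 ∧ a = c + 1 := by
        rcases ha with rfl | rfl
        exacts [⟨0, by omega, rfl⟩, ⟨1, by omega, rfl⟩]
      obtain ⟨m, rfl⟩ : ∃ m, l = m + 1 := ⟨l - 1, by omega⟩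
      have hlt : 2 * (2 * k + c) + 1 < M := by omega
      have e1 : posVec M (2 * k + (c + 1)) ⬝ᵥ posVec M (2 * k + (c + 1)) = 0 :=
        posVec_dotProduct_posVec hlt
      have e2 : posVec M (2 * k + (m + 1)) ⬝ᵥ posVec M (2 * k + (c + 1)) = 0 :=
        (dotProduct_comm _ _).trans (posVec_dotProduct_posVec hlt)
      have e3 : posVec M (2 * k + (c + 1)) ⬝ᵥ negVec M (2 * k + (m + 1)) = 0 :=
        (posVec_dotProduct_negVec (j := 2 * k + m) hlt).trans (if_neg (by omega))
      refine inU_commute ?_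
      rw [rootPlus, rootMinus, bracket_wedge, e1, e2, e3, wedge_self]
      simp
    rw [two_smul]
    nth_rw 2 [hc.eq]
    rfl

end CarrierInOrthogonal

end FullChain

/-! ### Commutators of the quadratic invariants. -/

namespace FullChain

open PowerSeries Finset

section CommutatorIdentities

variable {T : Type} [Ring T] {ι : Type} [Fintype ι]

theorem mul_sum_sq_of_commutator {z : T} {p c : ι → T} (h : ∀ i, z * p i = p i * z + c i) :
    z * ∑ i, p i ^ 2 = (∑ i, p i ^ 2) * z + ∑ i, (p i * c i + c i * p i) := by
  rw [mul_sum, sum_mul, ← sum_add_distrib]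
  refine sum_congr rfl fun i _ => ?_
  rw [pow_two, ← mul_assoc, h, add_mul, mul_assoc _ z, h]
  noncomm_ring

/-- A skew-symmetric infinitesimal rotation of two families of vectors preserves their contraction. -/
theorem commute_sum_mul_of_skew [Algebra ℂ T] {z : T} {p q : ι → T} {c : ι → ι → ℂ}
    (hp : ∀ i, z * p i = p i * z + ∑ j, c j i • p j)
    (hq : ∀ i, z * q i = q i * z + ∑ j, c j i • q j) (hc : ∀ i j, c i j = -c j i) :
    Commute z (∑ i, p i * q i) := by
  have h1 : ∑ i, ∑ j, c j i • (p j * q i) + ∑ i, ∑ j, c j i • (p i * q j) = 0 := by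
    rw [sum_comm, ← sum_add_distrib]
    refine sum_eq_zero fun i _ => ?_
    rw [← sum_add_distrib]
    refine sum_eq_zero fun j _ => ?_
    rw [hc i j, neg_smul, neg_add_cancel]
  rw [Commute, SemiconjBy, ← add_zero (_ * z), ← h1, mul_sum, sum_mul, ← sum_add_distrib,
    ← sum_add_distrib]
  refine sum_congr rfl fun i _ => ?_
  rw [← mul_assoc, hp, add_mul, mul_assoc (p i) z, hq, mul_add, sum_mul, mul_sum]
  simp only [smul_mul_assoc, mul_smul_comm, mul_assoc]
  abel

/-- One element `K = ½ ∑ (a_q b_q + b_q a_q)` governs everything: `x` turns one `b` into `-a`, `y`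
turns one `a` into `b` up to sign, and `[I₁, b_r] = e a_r` yields `[I₁, I₂] = e K`. -/
theorem CarrierRelations.commutators [Algebra ℂ T] [DecidableEq ι] {t e x y : T} {a b : ι → T}
    (h : CarrierRelations t e x y a b) {I₁ I₂ : T} (h₁ : I₁ = (1 / 2 : ℂ) • ∑ q, a q ^ 2)
    (h₂ : I₂ = (1 / 2 : ℂ) • ∑ q, b q ^ 2) :
    ∃ K, Commute e K ∧ x * I₂ = I₂ * x - K ∧ I₁ * y = y * I₁ + K ∧ I₁ * I₂ = I₂ * I₁ + e * K := by
  refine ⟨(1 / 2 : ℂ) • ∑ q, (a q * b q + b q * a q), ?_, ?_, ?_, ?_⟩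
  · exact (Commute.sum_right _ _ _ fun q _ => ((h.e_a q).mul_right (h.e_b q)).add_right
      ((h.e_b q).mul_right (h.e_a q))).smul_right _
  · have := mul_sum_sq_of_commutator (z := x) (p := b) (c := fun q => -a q) fun q => by
      rw [h.b_x]; abel
    rw [h₂, mul_smul_comm, this, smul_mul_assoc, ← smul_sub, sub_eq_add_neg, ← sum_neg_distrib]
    congr 2
    refine sum_congr rfl fun q _ => ?_
    noncomm_ring
  · have := mul_sum_sq_of_commutator (z := y) (p := a) (c := fun q => -b q) fun q => by
      rw [h.a_y]; abel
    rw [h₁, mul_smul_comm, this, smul_mul_assoc, ← smul_add]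
    congr 1
    rw [add_assoc, ← sum_add_distrib, left_eq_add]
    refine sum_eq_zero fun q _ => ?_
    noncomm_ring
  · have h3 (r : ι) : (∑ q, a q ^ 2) * b r = b r * ∑ q, a q ^ 2 + (2 : ℂ) • (e * a r) := by
      have := mul_sum_sq_of_commutator (z := b r) (p := a) (c := fun q => -if q = r then e else 0)
        fun q => by rw [h.a_b]; abel
      rw [this]
      simp only [mul_neg, neg_mul, ← neg_add, sum_neg_distrib, mul_ite, ite_mul, mul_zero, zero_mul,
        sum_add_distrib, sum_ite_eq', mem_univ, if_true, two_smul, (h.e_a r).eq]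
      abel
    have h4 (r : ι) : I₁ * b r = b r * I₁ + e * a r := by
      rw [h₁, smul_mul_assoc, h3, mul_smul_comm, smul_add, smul_smul]
      norm_num
    have := mul_sum_sq_of_commutator h4
    rw [h₂, mul_smul_comm, this, smul_mul_assoc, mul_smul_comm, mul_sum, ← smul_add]
    congr 2
    refine sum_congr rfl fun q _ => ?_
    rw [← mul_assoc, ← (h.e_b q).eq]
    noncomm_ring

/-- Expanding, the corrections to `h` are `η K v`, `-η K` and `η² e K v`; they sum to `η K ((1 + η
e) v - 1) = 0`. -/
theorem bracket_deformed_generators [Algebra ℂ T] {x y h e v η I₁ I₂ K : T} (hη : ∀ u : T, Commute η u)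
    (hxy : x * y = y * x + h) (hx : Commute v x)
    (h1 : Commute v I₁) (hv : (1 + η * e) * v = 1) (hK : Commute e K)
    (hK₂ : x * I₂ = I₂ * x - K) (hK₁ : I₁ * y = y * I₁ + K) (hI : I₁ * I₂ = I₂ * I₁ + e * K) :
    ⁅x - η * I₁, y - η * I₂ * v⁆ = h := by
  have e1 : η * I₁ * (η * I₂ * v) = η * (η * (I₂ * I₁ * v)) + η * (η * (e * K * v)) := by
    rw [show η * I₁ * (η * I₂ * v) = η * (I₁ * η) * I₂ * v by noncomm_ring, ← (hη I₁).eq,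
      show η * (η * I₁) * I₂ * v = η * (η * (I₁ * I₂ * v)) by noncomm_ring, hI]
    noncomm_ring
  have e2 : η * I₂ * v * (η * I₁) = η * (η * (I₂ * I₁ * v)) := by
    rw [show η * I₂ * v * (η * I₁) = η * I₂ * (v * η) * I₁ by noncomm_ring, ← (hη v).eq,
      show η * I₂ * (η * v) * I₁ = η * (I₂ * η) * (v * I₁) by noncomm_ring, ← (hη I₂).eq, h1.eq]
    noncomm_ring
  have e3 : x * (η * I₂ * v) = η * (I₂ * v * x) - η * (K * v) := by
    rw [← mul_assoc, ← mul_assoc, ← (hη x).eq, mul_assoc η, hK₂, mul_assoc I₂ v, hx.eq]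
    noncomm_ring
  have e4 : y * (η * I₁) = η * (I₁ * y) - η * K := by
    rw [← mul_assoc, ← (hη y).eq, hK₁]
    noncomm_ring
  have e5 : η * (K * v) + η * (η * (e * K * v)) = η * K := by
    have : v + η * (e * v) = 1 := by rw [← hv]; noncomm_ring
    rw [show η * (e * K * v) = η * K * (e * v) by rw [hK.eq]; noncomm_ring, (hη K).eq, ← mul_add,
      mul_assoc, ← mul_add, this, mul_one, (hη K).eq]
  have e6 : ⁅x - η * I₁, y - η * I₂ * v⁆ =
      x * y - x * (η * I₂ * v) - η * I₁ * y + η * I₁ * (η * I₂ * v) -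
        (y * x - y * (η * I₁) - η * I₂ * v * x + η * I₂ * v * (η * I₁)) := by
    rw [LieRing.of_associative_ring_bracket]
    noncomm_ring
  rw [e6, hxy, e3, e1, e2, e4, ← e5]
  noncomm_ring

end CommutatorIdentities

end FullChain

/-! ### The actual twist as an instance of the abstract one; primitivity. -/

namespace FullChain

open PowerSeries Finset

theorem map_smul_algHom {A B : Type} [Ring A] [Algebra ℂ A] [Ring B] [Algebra ℂ B] (θ : A →ₐ[ℂ] B)
    (c : ℂ) (f : A⟦X⟧) :
    PowerSeries.map θ.toRingHom (c • f) = c • PowerSeries.map θ.toRingHom f := by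
  ext n
  simp

theorem map_const {A B : Type} [Ring A] [Algebra ℂ A] [Ring B] [Algebra ℂ B] (θ : A →ₐ[ℂ] B)
    (u : A) : PowerSeries.map θ.toRingHom (const u) = const (θ u) :=
  PowerSeries.map_C θ.toRingHom u

theorem map_eta {A B : Type} [Ring A] [Ring B] (θ : A →+* B) :
    PowerSeries.map θ (eta : A⟦X⟧) = eta :=
  PowerSeries.map_X θ

theorem ringHom_sub_eta_mul {A B : Type} [Ring A] [Ring B] (θ : A⟦X⟧ →+* B⟦X⟧) (hθ : θ eta = eta)
    (u v : A⟦X⟧) : θ (u - eta * v) = θ u - eta * θ v := by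
  rw [map_sub, map_mul, hθ]

theorem ringHom_sub_eta_mul_mul {A B : Type} [Ring A] [Ring B] (θ : A⟦X⟧ →+* B⟦X⟧)
    (hθ : θ eta = eta) (u v w : A⟦X⟧) : θ (u - eta * v * w) = θ u - eta * θ v * θ w := by
  rw [map_sub, map_mul, map_mul, hθ]

theorem ringHom_one_add_eta_mul_mul {A B : Type} [Ring A] [Ring B] (θ : A⟦X⟧ →+* B⟦X⟧)
    (hθ : θ eta = eta) {u w : A⟦X⟧} (h : (1 + eta * u) * w = 1) : (1 + eta * θ u) * θ w = 1 := by
  rw [← hθ, ← map_mul, ← map_one θ, ← map_add, ← map_mul, h]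

theorem ringHom_mul_one_add_eta_mul {A B : Type} [Ring A] [Ring B] (θ : A⟦X⟧ →+* B⟦X⟧)
    (hθ : θ eta = eta) {u w : A⟦X⟧} (h : w * (1 + eta * u) = 1) : θ w * (1 + eta * θ u) = 1 := by
  rw [← hθ, ← map_mul, ← map_one θ, ← map_add, ← map_mul, h]

variable {M k : ℕ}

/-- `u ↦ u ⊗ 1`, as a constant power series. -/
noncomputable def constLeft (M : ℕ) : U M →ₐ[ℂ] (U M ⊗[ℂ] U M)⟦X⟧ :=
  const.comp Algebra.TensorProduct.includeLeft

/-- `u ↦ 1 ⊗ u`, as a constant power series. -/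
noncomputable def constRight (M : ℕ) : U M →ₐ[ℂ] (U M ⊗[ℂ] U M)⟦X⟧ :=
  const.comp Algebra.TensorProduct.includeRight

theorem inLeft_const (u : U M) : inLeft M (const u) = constLeft M u := map_const _ u

theorem inRight_const (u : U M) : inRight M (const u) = constRight M u := map_const _ u

theorem commute_constLeft_constRight (u v : U M) : Commute (constLeft M u) (constRight M v) :=
  commute_const (show Commute
      ((Algebra.TensorProduct.includeLeft : U M →ₐ[ℂ] U M ⊗[ℂ] U M) u)
      ((Algebra.TensorProduct.includeRight : U M →ₐ[ℂ] U M ⊗[ℂ] U M) v) by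
    rw [Commute, SemiconjBy, Algebra.TensorProduct.includeLeft_apply,
      Algebra.TensorProduct.includeRight_apply, Algebra.TensorProduct.tmul_mul_tmul,
      Algebra.TensorProduct.tmul_mul_tmul, one_mul, one_mul, mul_one, mul_one])

theorem const_tmul (u v : U M) : const (u ⊗ₜ[ℂ] v) = constLeft M u * constRight M v := by
  rw [constLeft, constRight, AlgHom.comp_apply, AlgHom.comp_apply, ← map_mul,
    Algebra.TensorProduct.includeLeft_apply, Algebra.TensorProduct.includeRight_apply,
    Algebra.TensorProduct.tmul_mul_tmul, one_mul, mul_one]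

theorem inRight_sigma : inRight M (sigma M k) = flog (eta * constRight M (inU M (rootInit M k))) := by
  rw [sigma, flog, inRight, map_compSeries, map_mul, map_eta, map_const]
  rfl

theorem twistSetting (hM : 4 * (k + 1) ≤ M) :
    TwistSetting (constLeft M) (constRight M) (inRight M (sigma M k)) (inU M (cartanPlus M k))
      (inU M (rootInit M k)) (inU M (root12 M k)) (inU M (root21 M k))
      (fun q => inU M (rootOrtho M k 1 q)) (fun q => inU M (rootOrtho M k 2 q)) where
  rel := carrierRelations hM
  comm := commute_constLeft_constRight
  constantCoeff_s := by rw [inRight_sigma]; exact constantCoeff_flog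
  fexp_s := by rw [inRight_sigma]; exact fexp_flog _
  comm_s z hz := by
    rw [inRight_sigma]
    exact commute_compSeries (by simp [eta]) _ ((commute_eta z).mul_left hz)

theorem twist_eq (hM : 4 * (k + 1) ≤ M) :
    twist M k = TwistSetting.extendedTwist (constLeft M) (constRight M) (inRight M (sigma M k))
      (inU M (cartanPlus M k)) (fun q => inU M (rootOrtho M k 1 q))
      (fun q => inU M (rootOrtho M k 2 q)) := by
  rw [twist, extension, jordanian, inLeft_const, TwistSetting.extendedTwist,
    TwistSetting.extExponent, invTensor_eq hM, map_sum, sum_congr rfl fun q _ => const_tmul _ _]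
  congr 3
  rw [inRight, fexp, map_compSeries, map_smul_algHom]
  rfl

theorem isUnit_twist (hM : 4 * (k + 1) ≤ M) : IsUnit (twist M k) :=
  twist_eq hM ▸ (twistSetting hM).isUnit_extendedTwist

theorem isTwistedPrimitive_of_semiconjBy (hM : 4 * (k + 1) ≤ M) {x : (U M)⟦X⟧}
    (h : SemiconjBy (twist M k) (PowerSeries.map (comul M).toRingHom x) (inLeft M x + inRight M x)) :
    IsTwistedPrimitive M k x := by
  rw [IsTwistedPrimitive, twistedComul, h.eq, mul_assoc, Ring.mul_inverse_cancel _ (isUnit_twist hM),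
    mul_one]

theorem map_comul_const_inU (u : so (Fin M) ℂ) :
    PowerSeries.map (comul M).toRingHom (const (inU M u)) =
      constLeft M (inU M u) + constRight M (inU M u) := by
  rw [map_const, comul, UniversalEnvelopingAlgebra.lift_ι_apply]
  exact map_add const _ _

theorem map_comul_const_sum_sq {ι : Type} [Fintype ι] (c : ℂ) (u : ι → so (Fin M) ℂ) :
    PowerSeries.map (comul M).toRingHom (const (c • ∑ q, inU M (u q) ^ 2)) =
      c • ∑ q, (constLeft M (inU M (u q)) + constRight M (inU M (u q))) ^ 2 := by
  rw [map_smul, map_smul_algHom, map_sum, map_sum]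
  simp only [map_pow, map_comul_const_inU]

theorem fexp_sigma : fexp (sigma M k) = 1 + eta * const (inU M (rootInit M k)) := fexp_flog _

theorem constantCoeff_sigma : constantCoeff (sigma M k) = 0 := constantCoeff_flog

theorem inLeft_eta : inLeft M eta = eta := map_eta _

theorem inRight_eta : inRight M eta = eta := map_eta _

theorem inLeft_const_sum_sq {ι : Type} [Fintype ι] (c : ℂ) (u : ι → U M) :
    inLeft M (const (c • ∑ q, u q ^ 2)) = c • ∑ q, constLeft M (u q) ^ 2 := by
  rw [inLeft_const, map_smul, map_sum]
  simp only [map_pow]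

theorem inRight_const_sum_sq {ι : Type} [Fintype ι] (c : ℂ) (u : ι → U M) :
    inRight M (const (c • ∑ q, u q ^ 2)) = c • ∑ q, constRight M (u q) ^ 2 := by
  rw [inRight_const, map_smul, map_sum]
  simp only [map_pow]

theorem isTwistedPrimitive_gen12 (hM : 4 * (k + 1) ≤ M) : IsTwistedPrimitive M k (gen12 M k) := by
  have h := (twistSetting hM).extendedTwist_x
  rw [← twist_eq hM, ← map_comul_const_inU, ← map_comul_const_sum_sq, ← inLeft_const_sum_sq,
    ← inRight_const_sum_sq, ← inLeft_const, ← inRight_const, ← inv_eq hM (Or.inl rfl)] at h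
  refine isTwistedPrimitive_of_semiconjBy hM ?_
  rw [gen12, ringHom_sub_eta_mul _ (map_eta _), ringHom_sub_eta_mul _ inLeft_eta,
    ringHom_sub_eta_mul _ inRight_eta]
  exact h

theorem isTwistedPrimitive_gen21 (hM : 4 * (k + 1) ≤ M) : IsTwistedPrimitive M k (gen21 M k) := by
  -- `e^{-σ}` enters only as the inverse of `1 + η E_{1+2}`, a relation that ring homomorphisms
  -- preserve.
  have h1 : (1 + eta * const (inU M (rootInit M k))) * fexp (-sigma M k) = 1 := by
    rw [← fexp_sigma, fexp_mul_fexp_neg constantCoeff_sigma]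
  have h2 : fexp (-sigma M k) * (1 + eta * const (inU M (rootInit M k))) = 1 := by
    rw [← fexp_sigma, fexp_neg_mul_fexp constantCoeff_sigma]
  have hv := ringHom_one_add_eta_mul_mul (inLeft M) inLeft_eta h1
  have hv' := ringHom_mul_one_add_eta_mul (inLeft M) inLeft_eta h2
  have hd := ringHom_one_add_eta_mul_mul (PowerSeries.map (comul M).toRingHom) (map_eta _) h1
  rw [inLeft_const] at hv hv'
  rw [map_comul_const_inU] at hd
  have h := (twistSetting hM).extendedTwist_y hv hv' hd
  have h3 : fexp (-inRight M (sigma M k)) = inRight M (fexp (-sigma M k)) := by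
    rw [inRight, fexp, fexp, map_compSeries, map_neg]
  rw [← twist_eq hM, ← map_comul_const_inU, ← map_comul_const_sum_sq, ← inLeft_const_sum_sq,
    ← inRight_const_sum_sq, ← inLeft_const, ← inRight_const, ← inv_eq hM (Or.inr rfl), h3] at h
  refine isTwistedPrimitive_of_semiconjBy hM ?_
  rw [gen21, ringHom_sub_eta_mul_mul _ (map_eta _), ringHom_sub_eta_mul_mul _ inLeft_eta,
    ringHom_sub_eta_mul_mul _ inRight_eta]
  exact h

/-- Elements of `so(M)` commuting with the Jordanian carrier and with the extension are primitive. -/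
theorem isTwistedPrimitive_const_inU (hM : 4 * (k + 1) ≤ M) {u : so (Fin M) ℂ}
    (ht : ⁅cartanPlus M k, u⁆ = 0) (he : ⁅rootInit M k, u⁆ = 0)
    (hI : Commute (constLeft M (inU M u) + constRight M (inU M u))
      (∑ q, constLeft M (inU M (rootOrtho M k 1 q)) * constRight M (inU M (rootOrtho M k 2 q)))) :
    IsTwistedPrimitive M k (const (inU M u)) := by
  refine isTwistedPrimitive_of_semiconjBy hM ?_
  have hS := twistSetting hM
  rw [map_comul_const_inU, inLeft_const, inRight_const, twist_eq hM]
  have h1 := (hS.jordanian_left_commute (inU_commute ht)).add_right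
    (hS.jordanian_right (inU_commute he))
  refine SemiconjBy.mul_left (TwistSetting.extension_commute ?_) h1
  exact ((commute_eta _).mul_left hI.symm).mul_left (hS.commute_fexp _
    ((commute_constLeft_constRight _ _).symm.add_right ((inU_commute he).map (constRight M))))

/-- Under `H_{1-2}` the elements `a_q` and `b_q` have weights `½` and `-½`, so `∑ a_q ⊗ b_q` has
weight zero. -/
theorem isTwistedPrimitive_genH (hM : 4 * (k + 1) ≤ M) : IsTwistedPrimitive M k (genH M k) := by
  refine isTwistedPrimitive_const_inU hM (bracket_cartanMinus_root hM).2.2.2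
    (by rw [← lie_skew, (bracket_cartanMinus_root hM).1, neg_zero]) ?_
  refine Commute.sum_right _ _ _ fun q _ => ?_
  have h1 := congrArg (constLeft M) (inU_mul (bracket_cartanMinus q hM).1)
  have h2 := congrArg (constRight M) (inU_mul (bracket_cartanMinus q hM).2)
  simp only [map_mul, map_add, map_neg, map_smul] at h1 h2
  rw [Commute, SemiconjBy, add_mul, ← mul_assoc, h1, ← mul_assoc, ← (commute_constLeft_constRight _ _).eq,
    mul_assoc _ (constRight M _) (constRight M _), h2, add_mul, mul_assoc _ (constLeft M _) _,
    (commute_constLeft_constRight _ _).eq]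
  simp only [smul_mul_assoc, mul_add, mul_neg, mul_smul_comm, mul_assoc]
  abel

end FullChain

/-! ### Action of `g_{k+1}` on the carrier. -/

namespace FullChain

open PowerSeries Finset Matrix

section Subalgebra

variable {M k : ℕ}

theorem so_skew {n : ℕ} (x : so (Fin n) ℂ) (i j : Fin n) : x.val i j = -x.val j i := by
  have h := (mem_so (Fin n) ℂ x.val).1 x.2
  have := congrFun (congrFun h j) i
  simpa using this

theorem soIncl_mulVec_eq_zero {s : ℕ} (x : so (Fin (M - s)) ℂ) {u : Fin M → ℂ}
    (hu : ∀ p : Fin M, s ≤ p.val → u p = 0) : (soIncl M s x).val *ᵥ u = 0 := by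
  have h : (shiftMatrix M s).transpose *ᵥ u = 0 := by
    funext q
    rw [mulVec, dotProduct, Pi.zero_apply]
    refine sum_eq_zero fun p _ => ?_
    simp only [shiftMatrix, Matrix.transpose_apply, Matrix.of_apply]
    split_ifs with hp
    · rw [hu p (by omega), mul_zero]
    · rw [zero_mul]
  change (shiftMatrix M s * x.val * (shiftMatrix M s).transpose) *ᵥ u = 0
  rw [← mulVec_mulVec, h, mulVec_zero]

theorem soIncl_mulVec_stdVec {s : ℕ} (x : so (Fin (M - s)) ℂ) (q : Fin (M - s)) :
    (soIncl M s x).val *ᵥ stdVec M (s + q) = ∑ r : Fin (M - s), x.val r q • stdVec M (s + r) := by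
  have h1 (w : Fin (M - s) → ℂ) :
      shiftMatrix M s *ᵥ w = ∑ r : Fin (M - s), w r • stdVec M (s + r) := by
    funext p
    rw [Finset.sum_apply, mulVec, dotProduct]
    refine sum_congr rfl fun r _ => ?_
    simp only [shiftMatrix, stdVec, Matrix.of_apply, Pi.smul_apply, smul_eq_mul, add_comm r.val s]
    rw [mul_comm]
  have h2 : stdVec M (s + q) = shiftMatrix M s *ᵥ Pi.single q 1 := by
    rw [h1, sum_eq_single q] <;> simp +contextual
  change (shiftMatrix M s * x.val * (shiftMatrix M s).transpose) *ᵥ _ = _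
  rw [h2, mulVec_mulVec, Matrix.mul_assoc, shiftMatrix_transpose_mul, Matrix.mul_one,
    ← mulVec_mulVec, h1]
  simp

theorem soIncl_injective (M s : ℕ) : Function.Injective (soIncl M s) := by
  intro x y h
  have h1 := congrArg Subtype.val h
  change shiftMatrix M s * x.val * (shiftMatrix M s).transpose =
    shiftMatrix M s * y.val * (shiftMatrix M s).transpose at h1
  have h2 (z : Matrix (Fin (M - s)) (Fin (M - s)) ℂ) : (shiftMatrix M s).transpose *
      (shiftMatrix M s * z * (shiftMatrix M s).transpose) * shiftMatrix M s = z := by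
    rw [Matrix.mul_assoc, Matrix.mul_assoc, shiftMatrix_transpose_mul, Matrix.mul_one,
      ← Matrix.mul_assoc, shiftMatrix_transpose_mul, Matrix.one_mul]
  exact Subtype.ext (by rw [← h2 x.val, h1, h2])

/-- The defining matrix representation is faithful and factors through `U(so(M))`; the
Poincaré–Birkhoff–Witt theorem is not needed. -/
theorem inU_injective (M : ℕ) : Function.Injective (inU M) := by
  intro x y h
  have := congrArg (UniversalEnvelopingAlgebra.lift ℂ (so (Fin M) ℂ).incl) h
  rw [UniversalEnvelopingAlgebra.lift_ι_apply, UniversalEnvelopingAlgebra.lift_ι_apply] at this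
  exact Subtype.ext this

theorem wedge_zero_right (a : Fin M → ℂ) : wedge a 0 = 0 := map_zero (wedgeLinear a)

theorem wedge_zero_left (a : Fin M → ℂ) : wedge 0 a = 0 := by
  rw [wedge_swap, wedge_zero_right, neg_zero]

variable (x : so (Fin (M - 4 * (k + 1))) ℂ)

theorem soIncl_mulVec_posVec {a : ℕ} (ha : a ≤ 2) :
    (soIncl M (4 * (k + 1)) x).val *ᵥ posVec M (2 * k + a) = 0 :=
  soIncl_mulVec_eq_zero x fun p hp => by
    rw [posVec, if_neg (by omega), if_neg (by omega)]

theorem soIncl_mulVec_negVec {a : ℕ} (ha : a ≤ 2) :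
    (soIncl M (4 * (k + 1)) x).val *ᵥ negVec M (2 * k + a) = 0 :=
  soIncl_mulVec_eq_zero x fun p hp => by
    rw [negVec, if_neg (by omega), if_neg (by omega)]

/-- `g_{k+1}` annihilates `v_1`, `v_2` and acts on the `ε_q` by its own matrix. -/
theorem bracket_soIncl_rootOrtho {a : ℕ} (ha : a ≤ 2) (q : Fin (M - 4 * (k + 1))) :
    ⁅soIncl M (4 * (k + 1)) x, rootOrtho M k a q⁆ = ∑ r, x.val r q • rootOrtho M k a r := by
  rw [rootOrtho, bracket_soIncl_wedge, soIncl_mulVec_posVec x ha, wedge_zero_left, zero_add,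
    soIncl_mulVec_stdVec, ← wedgeLinear_apply, map_sum]
  simp only [map_smul]
  rfl

theorem bracket_soIncl_root :
    ⁅soIncl M (4 * (k + 1)) x, rootInit M k⁆ = 0 ∧ ⁅soIncl M (4 * (k + 1)) x, root12 M k⁆ = 0 ∧
      ⁅soIncl M (4 * (k + 1)) x, root21 M k⁆ = 0 ∧
      ⁅soIncl M (4 * (k + 1)) x, cartan M k 1⁆ = 0 ∧
      ⁅soIncl M (4 * (k + 1)) x, cartan M k 2⁆ = 0 := by
  simp only [rootInit, root12, root21, cartan, bracket_soIncl_wedge, soIncl_mulVec_posVec,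
    soIncl_mulVec_negVec, wedge_zero_left, wedge_zero_right, add_zero, le_refl, one_le_two,
    and_self]

theorem bracket_soIncl_cartanPlus : ⁅soIncl M (4 * (k + 1)) x, cartanPlus M k⁆ = 0 := by
  obtain ⟨-, -, -, h1, h2⟩ := bracket_soIncl_root x
  rw [cartanPlus, lie_smul, lie_add, h1, h2, add_zero, smul_zero]

theorem bracket_soIncl_cartanMinus : ⁅soIncl M (4 * (k + 1)) x, cartanMinus M k⁆ = 0 := by
  obtain ⟨-, -, -, h1, h2⟩ := bracket_soIncl_root x
  rw [cartanMinus, lie_smul, lie_sub, h1, h2, sub_zero, smul_zero]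

theorem inU_soIncl_mul_rootOrtho {a : ℕ} (ha : a ≤ 2) (q : Fin (M - 4 * (k + 1))) :
    inU M (soIncl M (4 * (k + 1)) x) * inU M (rootOrtho M k a q) =
      inU M (rootOrtho M k a q) * inU M (soIncl M (4 * (k + 1)) x) +
        ∑ r, x.val r q • inU M (rootOrtho M k a r) := by
  rw [inU_mul (bracket_soIncl_rootOrtho x ha q), map_sum]
  simp only [map_smul]

theorem commute_soIncl_inv (hM : 4 * (k + 1) ≤ M) {a : ℕ} (ha : a = 1 ∨ a = 2) :
    Commute (inU M (soIncl M (4 * (k + 1)) x)) (inv M k a) := by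
  rw [inv_eq hM ha]
  simp only [pow_two]
  have ha' : a ≤ 2 := by omega
  exact (commute_sum_mul_of_skew (inU_soIncl_mul_rootOrtho x ha') (inU_soIncl_mul_rootOrtho x ha')
    (so_skew x)).smul_right _

theorem isTwistedPrimitive_gNextIncl (hM : 4 * (k + 1) ≤ M) :
    IsTwistedPrimitive M k (gNextIncl M k x) := by
  refine isTwistedPrimitive_const_inU hM (u := soIncl M (4 * (k + 1)) x)
    (by rw [← lie_skew, bracket_soIncl_cartanPlus, neg_zero])
    (by rw [← lie_skew, (bracket_soIncl_root x).1, neg_zero]) ?_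
  refine commute_sum_mul_of_skew (c := fun i j => x.val i j) (fun q => ?_) (fun q => ?_) (so_skew x)
  · have := congrArg (constLeft M) (inU_soIncl_mul_rootOrtho x (a := 1) (by omega) q)
    simp only [map_mul, map_add, map_sum, map_smul] at this
    rw [add_mul, this, mul_add (constLeft M _), ← (commute_constLeft_constRight _ _).eq]
    abel
  · have := congrArg (constRight M) (inU_soIncl_mul_rootOrtho x (a := 2) (by omega) q)
    simp only [map_mul, map_add, map_sum, map_smul] at this
    rw [add_mul, this, mul_add (constRight M _), (commute_constLeft_constRight _ _).eq]
    abel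

end Subalgebra

/-! ### The `so(3)` relations of the deformed generators. -/

section Brackets

variable {M k : ℕ}

theorem commute_fexp_neg_sigma {u : so (Fin M) ℂ} (h : ⁅rootInit M k, u⁆ = 0) :
    Commute (fexp (-sigma M k)) (const (inU M u)) := by
  have h1 : Commute (sigma M k) (const (inU M u)) :=
    commute_compSeries (by simp [eta]) _ ((commute_eta _).mul_left (commute_const (inU_commute h)))
  exact commute_compSeries (by simp [constantCoeff_sigma]) _ h1.neg_left

theorem commute_fexp_neg_sigma_inv (hM : 4 * (k + 1) ≤ M) :
    Commute (fexp (-sigma M k)) (const (inv M k 1)) := by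
  rw [inv_eq hM (Or.inl rfl), map_smul, map_sum]
  refine (Commute.sum_right _ _ _ fun q _ => ?_).smul_right _
  rw [map_pow]
  exact (commute_fexp_neg_sigma (bracket_rootInit q hM).1).pow_right 2

theorem bracket_gen12_gen21 (hM : 4 * (k + 1) ≤ M) :
    ⁅gen12 M k, gen21 M k⁆ = (2 : ℂ) • genH M k := by
  have hR := (carrierRelations hM).map (const (A := U M))
  have hsq (a : ℕ) (ha : a = 1 ∨ a = 2) : const (inv M k a) =
      (1 / 2 : ℂ) • ∑ q, const (inU M (rootOrtho M k a q)) ^ 2 := by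
    rw [inv_eq hM ha, map_smul, map_sum]
    simp only [map_pow]
  obtain ⟨K, hK, h2, h1, hI⟩ := hR.commutators (hsq 1 (Or.inl rfl)) (hsq 2 (Or.inr rfl))
  refine bracket_deformed_generators commute_eta ?_
    (commute_fexp_neg_sigma (bracket_rootInit_root hM).1) (commute_fexp_neg_sigma_inv hM) ?_ hK h2
    h1 hI
  · rw [← map_mul, inU_mul (bracket_root12_root21 hM), map_add, map_mul, map_smul, map_smul, genH]
  · rw [← fexp_sigma, fexp_mul_fexp_neg constantCoeff_sigma]

theorem bracket_genH_gen12 (hM : 4 * (k + 1) ≤ M) : ⁅genH M k, gen12 M k⁆ = gen12 M k := by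
  have h1 := congrArg (const (A := U M)) (inU_mul (bracket_cartanMinus_root hM).2.1)
  -- Each `a_q` has weight `½`, so `I^1` has the same weight `1` as `E_{1-2}`.
  have h2 := mul_sum_sq_of_commutator fun q => inU_mul (bracket_cartanMinus q hM).1
  have h3 : inU M (cartanMinus M k) * inv M k 1 =
      inv M k 1 * inU M (cartanMinus M k) + inv M k 1 := by
    rw [inv_eq hM (Or.inl rfl), mul_smul_comm, h2, smul_mul_assoc, ← smul_add]
    congr 2
    refine sum_congr rfl fun q _ => ?_
    rw [map_smul, mul_smul_comm, smul_mul_assoc, ← pow_two]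
    module
  have h4 := congrArg (const (A := U M)) h3
  simp only [map_add, map_mul] at h1 h4
  rw [LieRing.of_associative_ring_bracket, gen12, genH, mul_sub, sub_mul, h1, ← mul_assoc,
    ← (commute_eta _).eq, mul_assoc, h4]
  noncomm_ring

theorem bracket_genH_gen21 (hM : 4 * (k + 1) ≤ M) : ⁅genH M k, gen21 M k⁆ = -gen21 M k := by
  have h1 := congrArg (const (A := U M)) (inU_mul (bracket_cartanMinus_root hM).2.2.1)
  have h2 := mul_sum_sq_of_commutator fun q => inU_mul (bracket_cartanMinus q hM).2
  have h3 : inU M (cartanMinus M k) * inv M k 2 =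
      inv M k 2 * inU M (cartanMinus M k) - inv M k 2 := by
    rw [inv_eq hM (Or.inr rfl), mul_smul_comm, h2, smul_mul_assoc, ← smul_sub, sub_eq_add_neg,
      ← sum_neg_distrib]
    congr 2
    refine sum_congr rfl fun q _ => ?_
    rw [map_neg, map_smul, mul_neg, neg_mul, mul_smul_comm, smul_mul_assoc, ← pow_two]
    module
  have h4 := congrArg (const (A := U M)) h3
  have h5 : Commute (fexp (-sigma M k)) (const (inU M (cartanMinus M k))) :=
    commute_fexp_neg_sigma (by rw [← lie_skew, (bracket_cartanMinus_root hM).1, neg_zero])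
  simp only [map_add, map_sub, map_mul, map_neg] at h1 h4
  rw [LieRing.of_associative_ring_bracket, gen21, genH, mul_sub, sub_mul, h1, ← mul_assoc,
    ← mul_assoc, ← (commute_eta _).eq, mul_assoc eta _ (const _), h4, mul_assoc _ (fexp _), h5.eq]
  noncomm_ring

theorem commute_soIncl_generators (hM : 4 * (k + 1) ≤ M) (x : so (Fin (M - 4 * (k + 1))) ℂ) :
    Commute (gNextIncl M k x) (genH M k) ∧ Commute (gNextIncl M k x) (gen12 M k) ∧
      Commute (gNextIncl M k x) (gen21 M k) := by
  obtain ⟨h1, h2, h3, -, -⟩ := bracket_soIncl_root x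
  have hη (u : (U M)⟦X⟧) : Commute u eta := (commute_eta u).symm
  refine ⟨commute_const (inU_commute (bracket_soIncl_cartanMinus x)),
    (commute_const (inU_commute h2)).sub_right
      ((hη _).mul_right (commute_const (commute_soIncl_inv x hM (Or.inl rfl)))),
    (commute_const (inU_commute h3)).sub_right
      (((hη _).mul_right (commute_const (commute_soIncl_inv x hM (Or.inr rfl)))).mul_right
        (commute_fexp_neg_sigma (by rw [← lie_skew, h1, neg_zero])).symm)⟩

end Brackets

end FullChain

/-! ### The algebra `so_G(3)` and the deformed carrier space. -/

namespace FullChain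

open PowerSeries Finset Matrix

section SoThree

variable {T : Type} [Ring T] [Algebra ℂ T]

/-- The homomorphism from `so(3)` defined by a triple with the relations of `H_{1-2}`, `G_{1-2}`,
`G_{2-1}`. -/
noncomputable def soThreeHom (h x y : T) (hx : ⁅h, x⁆ = x) (hy : ⁅h, y⁆ = -y)
    (hxy : ⁅x, y⁆ = (2 : ℂ) • h) : so (Fin 3) ℂ →ₗ⁅ℂ⁆ T where
  -- `h` corresponds to `i` times the rotation of the first two coordinates, `x` and `y` to ladder
  -- combinations of the other two rotations.
  toFun X := (-Complex.I * X.val 1 0) • h + ((-Complex.I * X.val 2 1 - X.val 0 2) / 2) • x +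
    ((-Complex.I * X.val 2 1 + X.val 0 2) / 2) • y
  map_add' X Y := by
    simp only [so_val_add, Matrix.add_apply]
    module
  map_smul' c X := by
    simp only [so_val_smul, Matrix.smul_apply, smul_eq_mul, RingHom.id_apply]
    module
  map_lie' {X Y} := by
    have hx' : ⁅x, h⁆ = -x := by rw [← lie_skew, hx]
    have hy' : ⁅y, h⁆ = y := by rw [← lie_skew, hy, neg_neg]
    have hyx : ⁅y, x⁆ = -((2 : ℂ) • h) := by rw [← lie_skew, hxy]
    have d (Z : so (Fin 3) ℂ) (i : Fin 3) : Z.val i i = 0 := by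
      linear_combination (1 / 2 : ℂ) * so_skew Z i i
    have hb (i j : Fin 3) : ⁅X, Y⁆.val i j = (X.val * Y.val - Y.val * X.val) i j := rfl
    simp only [lie_add, add_lie, lie_smul, smul_lie, lie_self, hx, hy, hxy, hx', hy', hyx, hb,
      Matrix.sub_apply, Matrix.mul_apply, Fin.sum_univ_three, d]
    rw [so_skew X 0 1, so_skew X 1 2, so_skew X 2 0, so_skew Y 0 1, so_skew Y 1 2, so_skew Y 2 0]
    match_scalars <;> ring_nf <;> try (simp only [Complex.I_sq]; ring)

theorem soThreeHom_apply {h x y : T} (hx : ⁅h, x⁆ = x) (hy : ⁅h, y⁆ = -y)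
    (hxy : ⁅x, y⁆ = (2 : ℂ) • h) (X : so (Fin 3) ℂ) : soThreeHom h x y hx hy hxy X =
      (-Complex.I * X.val 1 0) • h + ((-Complex.I * X.val 2 1 - X.val 0 2) / 2) • x +
        ((-Complex.I * X.val 2 1 + X.val 0 2) / 2) • y := rfl

theorem exists_soThreeHom_eq {h x y : T} (hx : ⁅h, x⁆ = x) (hy : ⁅h, y⁆ = -y)
    (hxy : ⁅x, y⁆ = (2 : ℂ) • h) (α β γ : ℂ) :
    ∃ X, soThreeHom h x y hx hy hxy X = α • h + β • x + γ • y := by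
  -- The entries solve the three coefficient equations: `X 1 0 = iα`, `X 2 1 = i(β + γ)`, `X 0 2 = γ
  -- - β`.
  refine ⟨⟨!![0, -(Complex.I * α), γ - β; Complex.I * α, 0, -(Complex.I * (β + γ));
    -(γ - β), Complex.I * (β + γ), 0], ?_⟩, ?_⟩
  · rw [mem_so]
    ext i j
    fin_cases i <;> fin_cases j <;> simp
  · rw [soThreeHom_apply]
    simp only [Matrix.of_apply, Matrix.cons_val', Matrix.cons_val_zero, Matrix.cons_val_one,
      Matrix.cons_val]
    congr 1
    · congr 1
      · congr 1
        linear_combination (-α) * Complex.I_sq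
      · congr 1
        linear_combination (-(β + γ) / 2) * Complex.I_sq
    · congr 1
      linear_combination (-(β + γ) / 2) * Complex.I_sq

theorem range_soThreeHom {h x y : T} (hx : ⁅h, x⁆ = x) (hy : ⁅h, y⁆ = -y)
    (hxy : ⁅x, y⁆ = (2 : ℂ) • h) :
    (soThreeHom h x y hx hy hxy).range.toSubmodule = Submodule.span ℂ {h, x, y} := by
  ext z
  rw [Submodule.mem_span_triple]
  constructor
  · rintro ⟨X, rfl⟩
    exact ⟨_, _, _, (soThreeHom_apply hx hy hxy X).symm⟩
  · rintro ⟨α, β, γ, rfl⟩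
    obtain ⟨X, hX⟩ := exists_soThreeHom_eq hx hy hxy α β γ
    exact ⟨X, hX⟩

theorem so_three_eq_zero {X : so (Fin 3) ℂ} (h0 : -Complex.I * X.val 1 0 = 0)
    (h1 : (-Complex.I * X.val 2 1 - X.val 0 2) / 2 = 0)
    (h2 : (-Complex.I * X.val 2 1 + X.val 0 2) / 2 = 0) : X = 0 := by
  have e1 : X.val 1 0 = 0 := by simpa using h0
  have e2 : X.val 2 1 = 0 := by
    have : -Complex.I * X.val 2 1 = 0 := by linear_combination h1 + h2
    simpa using this
  have e3 : X.val 0 2 = 0 := by linear_combination h2 - h1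
  refine Subtype.ext ?_
  have d (i : Fin 3) : X.val i i = 0 := by
    linear_combination (1 / 2 : ℂ) * so_skew X i i
  ext i j
  have e1' := so_skew X 0 1
  have e2' := so_skew X 1 2
  have e3' := so_skew X 2 0
  rw [e1, neg_zero] at e1'
  rw [e2, neg_zero] at e2'
  rw [e3, neg_zero] at e3'
  fin_cases i <;> fin_cases j
  exacts [d 0, e1', e3, e1, d 1, e2', e3', e2, d 2]

/-- Two Lie algebra homomorphisms with commuting images define a homomorphism from the product. -/
def prodLieHom {L₁ L₂ : Type} [LieRing L₁] [LieAlgebra ℂ L₁] [LieRing L₂] [LieAlgebra ℂ L₂]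
    (f : L₁ →ₗ⁅ℂ⁆ T) (g : L₂ →ₗ⁅ℂ⁆ T) (h : ∀ u v, ⁅f u, g v⁆ = 0) : L₁ × L₂ →ₗ⁅ℂ⁆ T :=
  { f.toLinearMap.coprod g.toLinearMap with
    map_lie' := fun {u v} => by
      have h' : ⁅g u.2, f v.1⁆ = 0 := by rw [← lie_skew, h, neg_zero]
      change f ⁅u.1, v.1⁆ + g ⁅u.2, v.2⁆ = ⁅f u.1 + g u.2, f v.1 + g v.2⁆
      rw [LieHom.map_lie, LieHom.map_lie, add_lie, lie_add, lie_add, h, h', add_zero, zero_add] }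

end SoThree

section Carrier

variable {M k : ℕ}

theorem wedge_mulVec (a b u : Fin M → ℂ) :
    (wedge a b).val *ᵥ u = (b ⬝ᵥ u) • a - (a ⬝ᵥ u) • b := by
  rw [wedge_val, sub_mulVec, vecMulVec_mulVec, vecMulVec_mulVec]
  simp

/-- The summand from `g_{k+1}` kills `v_1` and `v_2`, while the other one sends `v_1` to `(α/2) v_1
- γ v_2` and `v_2` to `-(α/2) v_2 - β v_1`. Pairing with `v_{-1}`, `v_{-2}` reads off the
coefficients. -/
theorem eq_zero_of_soIncl_eq (hM : 4 * (k + 1) ≤ M) {x : so (Fin (M - 4 * (k + 1))) ℂ} {α β γ : ℂ}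
    (h : soIncl M (4 * (k + 1)) x + (α • cartanMinus M k + β • root12 M k + γ • root21 M k) = 0) :
    x = 0 ∧ α = 0 ∧ β = 0 ∧ γ = 0 := by
  have h1 := congrArg (fun z : so (Fin M) ℂ => z.val *ᵥ posVec M (2 * k + 1)) h
  have h2 := congrArg (fun z : so (Fin M) ℂ => z.val *ᵥ posVec M (2 * k + 2)) h
  simp only [so_val_add, so_val_smul, so_val_sub, cartanMinus, cartan, root12, root21, add_mulVec,
    sub_mulVec, smul_mulVec, wedge_mulVec, soIncl_mulVec_posVec x one_le_two,
    soIncl_mulVec_posVec x le_rfl, dotProduct_isotropic hM] at h1 h2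
  have h3 := congrArg (fun u => negVec M (2 * k + 1) ⬝ᵥ u) h1
  have h4 := congrArg (fun u => negVec M (2 * k + 2) ⬝ᵥ u) h1
  have h5 := congrArg (fun u => negVec M (2 * k + 1) ⬝ᵥ u) h2
  simp [dotProduct_add, dotProduct_smul, dotProduct_isotropic hM] at h3 h4 h5
  subst h3 h4 h5
  refine ⟨soIncl_injective M _ ?_, rfl, rfl, rfl⟩
  simpa using h

theorem gNextIncl_injective (M k : ℕ) : Function.Injective (gNextIncl M k) := fun _ _ h =>
  soIncl_injective M _ (inU_injective M (PowerSeries.C_injective h))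

/-- The twisted primitive elements form a subspace. -/
noncomputable def primitiveSubmodule (M k : ℕ) : Submodule ℂ (U M)⟦X⟧ where
  carrier := {x | IsTwistedPrimitive M k x}
  add_mem' {x y} hx hy := by
    simp only [Set.mem_ofPred_eq, IsTwistedPrimitive, twistedComul] at *
    rw [map_add, mul_add, add_mul, hx, hy, map_add, map_add]
    abel
  zero_mem' := by simp [IsTwistedPrimitive, twistedComul]
  smul_mem' c x hx := by
    simp only [Set.mem_ofPred_eq, IsTwistedPrimitive, twistedComul] at *
    rw [map_smul_algHom, mul_smul_comm, smul_mul_assoc, hx, inLeft, inRight, map_smul_algHom,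
      map_smul_algHom, smul_add]

/-- The homomorphism from `so(3)` onto `so_G(3)`. -/
noncomputable def soG (hM : 4 * (k + 1) ≤ M) : so (Fin 3) ℂ →ₗ⁅ℂ⁆ (U M)⟦X⟧ :=
  soThreeHom (genH M k) (gen12 M k) (gen21 M k) (bracket_genH_gen12 hM) (bracket_genH_gen21 hM)
    (bracket_gen12_gen21 hM)

theorem range_soG (hM : 4 * (k + 1) ≤ M) :
    (soG hM).range.toSubmodule = Submodule.span ℂ {genH M k, gen12 M k, gen21 M k} :=
  range_soThreeHom _ _ _

/-- At `η = 0` the deformed generators become `H_{1-2}`, `E_{1-2}`, `E_{2-1}`, so independence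
reduces to that of matrices in `so(M)`. -/
theorem eq_zero_of_gNextIncl_add_soG (hM : 4 * (k + 1) ≤ M) {x : so (Fin (M - 4 * (k + 1))) ℂ}
    {X : so (Fin 3) ℂ} (h : gNextIncl M k x + soG hM X = 0) : x = 0 ∧ X = 0 := by
  rw [soG, soThreeHom_apply] at h
  have h1 := congrArg (coeff 0) h
  have hc (u : U M) : coeff 0 (const u) = u := by rw [coeff_const, if_pos rfl]
  have e0 : coeff 0 (gNextIncl M k x) = inU M (soIncl M (4 * (k + 1)) x) := hc _
  have e1 : coeff 0 (genH M k) = inU M (cartanMinus M k) := hc _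
  have e2 : coeff 0 (gen12 M k) = inU M (root12 M k) := by
    rw [gen12, map_sub, hc, eta, coeff_zero_X_mul, sub_zero]
  have e3 : coeff 0 (gen21 M k) = inU M (root21 M k) := by
    rw [gen21, map_sub, hc, mul_assoc, eta, coeff_zero_X_mul, sub_zero]
  simp only [map_add, coeff_smul, e0, e1, e2, e3, map_zero] at h1
  simp only [← map_smul, ← map_add] at h1
  obtain ⟨hx, hα, hβ, hγ⟩ :=
    eq_zero_of_soIncl_eq hM (inU_injective M (h1.trans (map_zero (inU M)).symm))
  exact ⟨hx, so_three_eq_zero hα hβ hγ⟩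

theorem bracket_gNextIncl_soG (hM : 4 * (k + 1) ≤ M) (x : so (Fin (M - 4 * (k + 1))) ℂ)
    (X : so (Fin 3) ℂ) : ⁅gNextIncl M k x, soG hM X⁆ = 0 := by
  obtain ⟨h0, h1, h2⟩ := commute_soIncl_generators hM x
  rw [soG, soThreeHom_apply, LieRing.of_associative_ring_bracket, sub_eq_zero]
  exact (((h0.smul_right _).add_right (h1.smul_right _)).add_right (h2.smul_right _)).eq

end Carrier

end FullChain

theorem mainTheorem1 (M k : ℕ) (hM : 4 * (k + 1) ≤ M) :
    IsUnit (FullChain.twist M k) ∧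
    -- the `I^a` are invariants of `g_{k+1}`
    (∀ x : so (Fin (M - 4 * (k + 1))) ℂ, ∀ a ∈ ({1, 2} : Set ℕ),
      ⁅FullChain.inU M (FullChain.soIncl M (4 * (k + 1)) x), FullChain.inv M k a⁆ = 0) ∧
    -- the generators are primitive
    FullChain.IsTwistedPrimitive M k (FullChain.gen12 M k) ∧
    FullChain.IsTwistedPrimitive M k (FullChain.gen21 M k) ∧
    FullChain.IsTwistedPrimitive M k (FullChain.genH M k) ∧
    -- the commutation relations
    ⁅FullChain.genH M k, FullChain.gen12 M k⁆ = FullChain.gen12 M k ∧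
    ⁅FullChain.genH M k, FullChain.gen21 M k⁆ = -FullChain.gen21 M k ∧
    ⁅FullChain.gen12 M k, FullChain.gen21 M k⁆ = (2 : ℂ) • FullChain.genH M k ∧
    -- `S` is the primitive subalgebra `so_G(3)`, `V` the deformed carrier space
    ∃ S V : LieSubalgebra ℂ (FullChain.U M)⟦X⟧,
      S.toSubmodule =
        Submodule.span ℂ {FullChain.genH M k, FullChain.gen12 M k, FullChain.gen21 M k} ∧
      Nonempty (S ≃ₗ⁅ℂ⁆ so (Fin 3) ℂ) ∧
      (∀ x ∈ S, FullChain.IsTwistedPrimitive M k x) ∧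
      Function.Injective (FullChain.gNextIncl M k) ∧
      Disjoint (FullChain.gNext M k).toSubmodule S.toSubmodule ∧
      V.toSubmodule = (FullChain.gNext M k).toSubmodule ⊔ S.toSubmodule ∧
      (∀ x ∈ FullChain.gNext M k, ∀ y ∈ S, ⁅x, y⁆ = 0) ∧
      Nonempty (V ≃ₗ⁅ℂ⁆ (so (Fin (M - 4 * (k + 1))) ℂ × so (Fin 3) ℂ)) ∧
      (∀ x ∈ V, FullChain.IsTwistedPrimitive M k x) := by
  open FullChain in
  have p12 := isTwistedPrimitive_gen12 hM
  have p21 := isTwistedPrimitive_gen21 hM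
  have pH := isTwistedPrimitive_genH hM
  have hS : (soG hM).range.toSubmodule ≤ primitiveSubmodule M k := by
    rw [range_soG, Submodule.span_le]
    rintro z (rfl | rfl | rfl)
    exacts [pH, p12, p21]
  have hg : (gNext M k).toSubmodule ≤ primitiveSubmodule M k := by
    rintro _ ⟨x, rfl⟩
    exact isTwistedPrimitive_gNextIncl x hM
  -- The carrier space `V` is taken to be the range of this homomorphism from the product;
  -- injectivity identifies it with the product Lie algebra.
  have hinj : Function.Injective (prodLieHom (gNextIncl M k) (soG hM) (bracket_gNextIncl_soG hM)) :=
    (injective_iff_map_eq_zero _).2 fun u hu => by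
      obtain ⟨h1, h2⟩ := eq_zero_of_gNextIncl_add_soG hM hu
      exact Prod.ext h1 h2
  have hinjS : Function.Injective (soG hM) := (injective_iff_map_eq_zero _).2 fun u hu =>
    (eq_zero_of_gNextIncl_add_soG hM (x := 0) (by rw [hu, map_zero, add_zero])).2
  have hV : (prodLieHom (gNextIncl M k) (soG hM) (bracket_gNextIncl_soG hM)).range.toSubmodule =
      (gNext M k).toSubmodule ⊔ (soG hM).range.toSubmodule :=
    LinearMap.range_coprod _ _
  refine ⟨isUnit_twist hM, fun x a ha => ?_, p12, p21, pH, bracket_genH_gen12 hM,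
    bracket_genH_gen21 hM, bracket_gen12_gen21 hM, (soG hM).range, _, range_soG hM,
    ⟨(LieEquiv.ofInjective _ hinjS).symm⟩, fun x hx => hS hx, gNextIncl_injective M k, ?_, hV, ?_,
    ⟨(LieEquiv.ofInjective _ hinj).symm⟩, fun x hx => (sup_le hg hS) (hV ▸ hx)⟩
  · rw [LieRing.of_associative_ring_bracket, sub_eq_zero]
    exact (commute_soIncl_inv x hM ha).eq
  · rw [Submodule.disjoint_def]
    rintro _ ⟨x, rfl⟩ ⟨X, hX⟩
    have := (eq_zero_of_gNextIncl_add_soG hM (x := x) (X := -X)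
      (by rw [map_neg]; exact add_neg_eq_zero.2 hX.symm)).1
    rw [this]
    exact map_zero (gNextIncl M k)
  · rintro _ ⟨x, rfl⟩ _ ⟨X, rfl⟩
    exact bracket_gNextIncl_soG hM x X
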